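/- Conventions. Let $h\in\{2,3,\dots\}\cup\{\infty\}$ and $h-1\le r\le h$ (so $r\in\{h-1,h\}$; $\infty-1=\infty$). Let $M$ be a manifold without boundary of class $C^h$ and real dimension $2n+1$, with a hyperplane field $D\subset TM$ and a complex structure $J$ on $D$. Assume that $(M,D,J)$ is projective: there is a CR embedding $j\colon M\to\mathbb{CP}^N$ of class $C^h$, that is, a topological embedding and immersion with $j_*(Jv)=i\,j_*v$ for $v\in D$ (then $D^{1,0}$ is automatically involutive). Assume that it is Levi-flat: $D$ is tangent to a foliation of class $C^r$. CR coordinates centered at $x\in M$ are $C^r$ coordinates $(z^1,\dots,z^n,s)$ with values in $\mathbb{C}^n\times\mathbb{R}$, defined near $x$ and vanishing at $x$, whose differential maps $(D,J)$ complex linearly to $\mathbb{C}^n\times 0$. Let $P_0,P_1$ be linearly independent homogeneous polynomials of degree $k$ on $\mathbb{C}^{N+1}$ such that any two distinct hypersurfaces of the pencil spanned by them intersect transversally, and put $\tilde B=\{P_0=P_1=0\}$, $\Phi=[P_0:P_1]\colon\mathbb{CP}^N\setminus\tilde B\to\mathbb{CP}^1$, $B=j^{-1}(\tilde B)$ and $\phi=\Phi\circ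 j\colon M\setminus B\to\mathbb{CP}^1$. Assume that the pencil is a Lefschetz pencil structure on $M$: (i) $\tilde B$ is transversal to $M$; (ii) the CR 1-jet $(\phi,\nabla_D\phi)$ is transversal along $D$ to the set of jets with vanishing degree one part: at each $x\in M\setminus B$ with $\nabla_D\phi(x)=0$, the derivative along $D_x$ of the section $\nabla_D\phi$ maps $D_x$ onto $\mathrm{Hom}_{\mathbb C}(D_x,T_{\phi(x)}\mathbb{CP}^1)$; (iii) with $TM^J$ the smallest complex subbundle of $T\mathbb{CP}^N|_M$ containing $TM$, the holomorphic 1-jet $(\Phi,\nabla_{TM^J}\Phi)$ is transversal along $M$ to the set of jets along $TM^J$ with vanishing degree one part. Let $\Delta$ be the set of all $x\in M\setminus B$ at which $\nabla_D\phi$ vanishes. Proposition. (1) For every $x\in B$ one has $n\ge2$ and there exist CR coordinates $(z^1,\dots,z^n,s)$ centered at $x$ and a holomorphic chart $\psi$ of $\mathbb{CP}^1$ such that, on the domain of the coordinates, $B=\{z^1=z^2=0\}$ and, off $B$, $\phi=z^2/z^1$ in the chart $\psi$ (that is, $\phi(y)$ lies in the domain of $\psi$ if and only if $z^1(y)\neq0$,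 and then $\psi(\phi(y))=z^2(y)/z^1(y)$). (2) For every $x\in\Delta$ there exist CR coordinates $(z^1,\dots,z^n,s)$ centered at $x$, with domain disjoint from $B$, a holomorphic chart $\psi$ of $\mathbb{CP}^1$ whose domain contains the image under $\phi$ of the coordinate domain, and a complex-valued function $t$ of class $C^{h-1}$ of one real variable, defined on the set of values of $s$, such that on the coordinate domain $$\psi(\phi(z^1,\dots,z^n,s))=(z^1)^2+\cdots+(z^n)^2+t(s),\qquad t(0)=0,\quad t'(0)\neq0.$$ -/

import Mathlib

open scoped Manifold ContDiff Topology

noncomputable section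

/-! ### Complex projective space as a complex manifold -/

/-- Complex projective space of complex dimension `N`. -/
abbrev CPSpace (N : ℕ) : Type := Projectivization ℂ (Fin (N + 1) → ℂ)

namespace CPSpace

variable {N : ℕ}

/-- The quotient topology. -/
instance instTopologicalSpace : TopologicalSpace (CPSpace N) :=
  inferInstanceAs (TopologicalSpace (Quotient (projectivizationSetoid ℂ (Fin (N + 1) → ℂ))))

theorem isQuotientMap_mk' :
    Topology.IsQuotientMap (Projectivization.mk' ℂ (V := Fin (N + 1) → ℂ)) :=
  isQuotientMap_quot_mk

/-- The affine coordinates `Z_k / Z_i` (`k ≠ i`) of a point. -/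
def affineCoord (i : Fin (N + 1)) (p : CPSpace N) : Fin N → ℂ :=
  fun k => p.rep (i.succAbove k) / p.rep i

theorem insertNth_one_ne_zero (i : Fin (N + 1)) (u : Fin N → ℂ) :
    (i.insertNth (1 : ℂ) u : Fin (N + 1) → ℂ) ≠ 0 := by
  intro h
  have := congrFun h i
  simp at this

/-- The point with `Z_i = 1` and the other homogeneous coordinates given by `u`. -/
def ofAffine (i : Fin (N + 1)) (u : Fin N → ℂ) : CPSpace N :=
  Projectivization.mk ℂ (i.insertNth (1 : ℂ) u) (insertNth_one_ne_zero i u)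

theorem rep_mk_apply_ne_zero_iff (i : Fin (N + 1)) (v : Fin (N + 1) → ℂ) (hv : v ≠ 0) :
    (Projectivization.mk ℂ v hv).rep i ≠ 0 ↔ v i ≠ 0 := by
  obtain ⟨a, ha⟩ := Projectivization.exists_smul_eq_mk_rep ℂ v hv
  rw [← ha]
  simp [Units.smul_def]

theorem affineCoord_mk (i : Fin (N + 1)) (v : Fin (N + 1) → ℂ) (hv : v ≠ 0) :
    affineCoord i (Projectivization.mk ℂ v hv) = fun k => v (i.succAbove k) / v i := by
  obtain ⟨a, ha⟩ := Projectivization.exists_smul_eq_mk_rep ℂ v hv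
  funext k
  simp only [affineCoord]
  rw [← ha]
  simp only [Units.smul_def, Pi.smul_apply, smul_eq_mul]
  exact mul_div_mul_left _ _ a.ne_zero

theorem affineCoord_ofAffine (i : Fin (N + 1)) (u : Fin N → ℂ) :
    affineCoord i (ofAffine i u) = u := by
  rw [ofAffine, affineCoord_mk]
  funext k
  simp

theorem ofAffine_affineCoord (i : Fin (N + 1)) (p : CPSpace N) (hp : p.rep i ≠ 0) :
    ofAffine i (affineCoord i p) = p := by
  conv_rhs => rw [← p.mk_rep]
  rw [ofAffine, Projectivization.mk_eq_mk_iff']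
  refine ⟨(p.rep i)⁻¹, ?_⟩
  funext k
  refine Fin.succAboveCases i ?_ (fun k => ?_) k
  · simp [hp]
  · simp [affineCoord, div_eq_inv_mul]

theorem isOpen_rep_ne_zero (i : Fin (N + 1)) : IsOpen {p : CPSpace N | p.rep i ≠ 0} := by
  rw [← isQuotientMap_mk'.isOpen_preimage]
  have : (Projectivization.mk' ℂ (V := Fin (N + 1) → ℂ)) ⁻¹' {p : CPSpace N | p.rep i ≠ 0}
      = {v : {v : Fin (N + 1) → ℂ // v ≠ 0} | v.1 i ≠ 0} := by
    ext v
    exact rep_mk_apply_ne_zero_iff i v.1 v.2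
  rw [this]
  exact isOpen_ne_fun ((continuous_apply i).comp continuous_subtype_val) continuous_const

theorem continuousOn_affineCoord (i : Fin (N + 1)) :
    ContinuousOn (affineCoord i) {p : CPSpace N | p.rep i ≠ 0} := by
  rw [isQuotientMap_mk'.continuousOn_isOpen_iff (isOpen_rep_ne_zero i)]
  have h : (affineCoord i ∘ Projectivization.mk' ℂ (V := Fin (N + 1) → ℂ))
      = fun (v : {v : Fin (N + 1) → ℂ // v ≠ 0}) k => v.1 (i.succAbove k) / v.1 i := by
    funext v
    exact affineCoord_mk i v.1 v.2
  rw [h]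
  refine continuousOn_pi.2 fun k => ContinuousOn.div ?_ ?_ ?_
  · exact ((continuous_apply _).comp continuous_subtype_val).continuousOn
  · exact ((continuous_apply _).comp continuous_subtype_val).continuousOn
  · intro v hv
    exact (rep_mk_apply_ne_zero_iff i v.1 v.2).1 hv

theorem continuous_ofAffine (i : Fin (N + 1)) : Continuous (ofAffine (N := N) i) := by
  have h : Continuous fun u : Fin N → ℂ =>
      (⟨i.insertNth (1 : ℂ) u, insertNth_one_ne_zero i u⟩ : {v : Fin (N + 1) → ℂ // v ≠ 0}) :=
    Continuous.subtype_mk (Continuous.finInsertNth (A := fun _ => ℂ) i continuous_const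
      continuous_id) _
  exact isQuotientMap_mk'.continuous.comp h

/-- The standard affine chart on `{Z_i ≠ 0}`. -/
def affineChart (i : Fin (N + 1)) : OpenPartialHomeomorph (CPSpace N) (Fin N → ℂ) where
  toFun := affineCoord i
  invFun := ofAffine i
  source := {p | p.rep i ≠ 0}
  target := Set.univ
  map_source' _ _ := Set.mem_univ _
  map_target' u _ := (rep_mk_apply_ne_zero_iff i _ (insertNth_one_ne_zero i u)).2 (by simp)
  left_inv' p hp := ofAffine_affineCoord i p hp
  right_inv' u _ := affineCoord_ofAffine i u
  open_source := isOpen_rep_ne_zero i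
  open_target := isOpen_univ
  continuousOn_toFun := continuousOn_affineCoord i
  continuousOn_invFun := (continuous_ofAffine i).continuousOn

/-- An index of a nonzero homogeneous coordinate of `p`. -/
def index (p : CPSpace N) : Fin (N + 1) :=
  Classical.choose (Function.ne_iff.1 p.rep_nonzero)

theorem rep_index_ne_zero (p : CPSpace N) : p.rep (index p) ≠ 0 :=
  Classical.choose_spec (Function.ne_iff.1 p.rep_nonzero)

instance instChartedSpace : ChartedSpace (Fin N → ℂ) (CPSpace N) where
  atlas := Set.range affineChart
  chartAt p := affineChart (index p)
  mem_chart_source p := rep_index_ne_zero p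
  chart_mem_atlas p := ⟨index p, rfl⟩

theorem contDiffOn_transition (i i' : Fin (N + 1)) :
    ContDiffOn ℂ ω ((affineChart (N := N) i).symm.trans (affineChart i'))
      ((affineChart (N := N) i).symm.trans (affineChart i')).source := by
  have h : ∀ u, ((affineChart (N := N) i).symm.trans (affineChart i')) u =
      fun k => (i.insertNth (1 : ℂ) u : Fin (N + 1) → ℂ) (i'.succAbove k) /
        (i.insertNth (1 : ℂ) u : Fin (N + 1) → ℂ) i' := fun u =>
    affineCoord_mk i' _ (insertNth_one_ne_zero i u)
  have hc : ∀ l : Fin (N + 1),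
      ContDiff ℂ ω (fun u : Fin N → ℂ => (i.insertNth (1 : ℂ) u : Fin (N + 1) → ℂ) l) := by
    intro l
    refine Fin.succAboveCases i ?_ (fun k => ?_) l
    · simpa using contDiff_const
    · simpa using contDiff_apply ℂ ℂ k
  refine ContDiffOn.congr ?_ (fun u _ => h u)
  refine contDiffOn_pi.2 fun k => ContDiffOn.div (hc _).contDiffOn (hc _).contDiffOn ?_
  intro u hu
  have : (affineChart (N := N) i).symm u ∈ (affineChart (N := N) i').source := by
    exact hu.2
  exact (rep_mk_apply_ne_zero_iff i' _ (insertNth_one_ne_zero i u)).1 this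

/-- `CPSpace N` is a complex manifold. -/
instance instIsManifoldComplex : IsManifold 𝓘(ℂ, Fin N → ℂ) ω (CPSpace N) := by
  apply isManifold_of_contDiffOn
  rintro _ _ ⟨i, rfl⟩ ⟨i', rfl⟩
  simpa using contDiffOn_transition i i'

/-- The underlying real manifold of `CPSpace N`. -/
instance instIsManifoldReal : IsManifold 𝓘(ℝ, Fin N → ℂ) ω (CPSpace N) := by
  apply isManifold_of_contDiffOn
  rintro _ _ ⟨i, rfl⟩ ⟨i', rfl⟩
  simpa using (contDiffOn_transition i i').restrict_scalars ℝ

/-- The zero set in projective space of a homogeneous polynomial. -/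
def zeroSet (P : MvPolynomial (Fin (N + 1)) ℂ) : Set (CPSpace N) :=
  {p | MvPolynomial.eval p.rep P = 0}

/-- The differential at `p` of the local equation of `{P = 0}` obtained by dehomogenizing `P` in
the preferred affine chart at `p`, as a form on the tangent space at `p`. -/
def diffAt (P : MvPolynomial (Fin (N + 1)) ℂ) (p : CPSpace N) : (Fin N → ℂ) →L[ℂ] ℂ :=
  fderiv ℂ (fun u : Fin N → ℂ =>
    MvPolynomial.eval ((index p).insertNth (1 : ℂ) u : Fin (N + 1) → ℂ) P)
    (chartAt (Fin N → ℂ) p p)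

/-- The base locus of the pencil spanned by `P₀` and `P₁`. -/
def baseLocus (P₀ P₁ : MvPolynomial (Fin (N + 1)) ℂ) : Set (CPSpace N) :=
  zeroSet P₀ ∩ zeroSet P₁

open Classical in
/-- The map `p ↦ [P₀(p) : P₁(p)]` to the projective line. The value on the base locus is an
irrelevant constant. -/
def pencilMap (P₀ P₁ : MvPolynomial (Fin (N + 1)) ℂ) (p : CPSpace N) : CPSpace 1 :=
  if h : (![MvPolynomial.eval p.rep P₀, MvPolynomial.eval p.rep P₁] : Fin 2 → ℂ) = 0 then
    ofAffine 0 0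
  else Projectivization.mk ℂ _ h

/-- The preferred affine coordinate of the projective line around `q`. -/
def lineCoord (q : CPSpace 1) : CPSpace 1 → ℂ :=
  fun q' => chartAt (Fin 1 → ℂ) q q' 0

end CPSpace

open CPSpace

/-! ### CR structures of hypersurface type -/

variable {n N : ℕ}

/-- The model of a boundaryless manifold of real dimension `2n + 1`. -/
abbrev RModel (n : ℕ) := 𝓘(ℝ, EuclideanSpace ℝ (Fin (2 * n + 1)))

/-- A field `D` of tangent hyperplanes with a complex structure `J` on each of them. Neither the
regularity nor the involutivity of `D^{1,0}` is required here: both are automatic for the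
structures with a CR embedding in projective space, the only ones considered below. -/
structure AlmostCRStructure (n : ℕ) (M : Type*) [TopologicalSpace M]
    [ChartedSpace (EuclideanSpace ℝ (Fin (2 * n + 1))) M] where
  D : ∀ x : M, Submodule ℝ (TangentSpace (RModel n) x)
  J : ∀ x : M, D x →ₗ[ℝ] D x
  finrank_D : ∀ x, Module.finrank ℝ (D x) = 2 * n
  J_J : ∀ x v, J x (J x v) = -v

variable {M : Type*} [TopologicalSpace M] [ChartedSpace (EuclideanSpace ℝ (Fin (2 * n + 1))) M]

/-- The differential at `x` of a map to projective space, with values in the complex vector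
space `T ℂP^N`. -/
def diffCP (n : ℕ) {M : Type*} [TopologicalSpace M]
    [ChartedSpace (EuclideanSpace ℝ (Fin (2 * n + 1))) M] (j : M → CPSpace N) (x : M) : TangentSpace (RModel n) x →L[ℝ] (Fin N → ℂ) :=
  mfderiv (RModel n) 𝓘(ℝ, Fin N → ℂ) j x

/-- The differential at `x` of a complex-valued function. -/
def diffC (n : ℕ) {M : Type*} [TopologicalSpace M]
    [ChartedSpace (EuclideanSpace ℝ (Fin (2 * n + 1))) M] (c : M → ℂ) (x : M) : TangentSpace (RModel n) x →L[ℝ] ℂ :=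
  mfderiv (RModel n) 𝓘(ℝ, ℂ) c x

/-- The differential at `x` of a map to `ℂ^m`. -/
def diffCm (n : ℕ) {M : Type*} [TopologicalSpace M]
    [ChartedSpace (EuclideanSpace ℝ (Fin (2 * n + 1))) M] {m : ℕ} (F : M → (Fin m → ℂ)) (x : M) :
    TangentSpace (RModel n) x →L[ℝ] (Fin m → ℂ) :=
  mfderiv (RModel n) 𝓘(ℝ, Fin m → ℂ) F x

/-- The differential at `x` of a map to `ℂ^n × ℝ`. -/
def diffCR (e : M → (Fin n → ℂ) × ℝ) (x : M) :
    TangentSpace (RModel n) x →L[ℝ] (Fin n → ℂ) × ℝ :=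
  mfderiv (RModel n) 𝓘(ℝ, (Fin n → ℂ) × ℝ) e x

namespace AlmostCRStructure

variable (S : AlmostCRStructure n M)

/-- `D` integrates into a foliation of class `C^r` (of real codimension one): locally the leaves
are the level sets of a `C^r` submersion to `ℝ`. -/
def IsLeviFlat (r : ℕ∞) : Prop :=
  ∀ x : M, ∃ U : Set M, IsOpen U ∧ x ∈ U ∧ ∃ s : M → ℝ,
    ContMDiffOn (RModel n) 𝓘(ℝ, ℝ) (r : ℕ∞ω) s U ∧
    ∀ y ∈ U, (mfderiv (RModel n) 𝓘(ℝ, ℝ) s y).ker = S.D y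

/-- `j` is a CR embedding of class `C^h` in projective space. -/
structure IsCREmbedding (h : ℕ∞) (j : M → CPSpace N) : Prop where
  contMDiff : ContMDiff (RModel n) 𝓘(ℝ, Fin N → ℂ) (h : ℕ∞ω) j
  isEmbedding : Topology.IsEmbedding j
  injective_diff : ∀ x, Function.Injective (diffCP n j x)
  map_J : ∀ x (v : S.D x), diffCP n j x (S.J x v) = Complex.I • diffCP n j x v

/-- `e = (z, s)` are CR coordinates of class `C^r` centered at `x`: a `C^r` diffeomorphism from
an open neighbourhood of `x` to an open subset of the Levi-flat CR manifold `ℂ^n × ℝ` that maps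
`D` to `ℂ^n × 0` complex linearly. -/
structure IsCRChartAt (r : ℕ∞) (x : M) (e : OpenPartialHomeomorph M ((Fin n → ℂ) × ℝ)) :
    Prop where
  mem_source : x ∈ e.source
  map_center : e x = 0
  contMDiffOn : ContMDiffOn (RModel n) 𝓘(ℝ, (Fin n → ℂ) × ℝ) (r : ℕ∞ω) e e.source
  contMDiffOn_symm : ContMDiffOn 𝓘(ℝ, (Fin n → ℂ) × ℝ) (RModel n) (r : ℕ∞ω) e.symm e.target
  map_D : ∀ y ∈ e.source, ∀ v : S.D y, (diffCR e y v).2 = 0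
  map_J : ∀ y ∈ e.source, ∀ v : S.D y,
    (diffCR e y (S.J y v)).1 = Complex.I • (diffCR e y v).1

end AlmostCRStructure

/-! ### Transversality of 1-jets -/

/-- Let `σ = (a, F)` be (the local expression of) a section of a bundle with fibre `A × B`, with
`F = 0` at the point at hand. The section is transversal there, along the subspace `P` of the
tangent space `T` of the base, to `Σ = {F = 0}` if `P̂ = P × A × B` is spanned by its
intersections with the tangent space of the graph of `σ` and with the tangent space of `Σ`. -/
def TransversalAlong {T A B : Type*} [AddCommGroup T] [Module ℝ T] [AddCommGroup A] [Module ℝ A]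
    [AddCommGroup B] [Module ℝ B] (P : Submodule ℝ T) (da : T →ₗ[ℝ] A) (dF : T →ₗ[ℝ] B) : Prop :=
  let hatP : Submodule ℝ (T × A × B) := P.prod ⊤
  let tangentGraph : Submodule ℝ (T × A × B) := (LinearMap.id.prod (da.prod dF)).range
  let tangentSigma : Submodule ℝ (T × A × B) :=
    (⊤ : Submodule ℝ T).prod ((⊤ : Submodule ℝ A).prod (⊥ : Submodule ℝ B))
  (tangentGraph ⊓ hatP) ⊔ (tangentSigma ⊓ hatP) = hatP

namespace AlmostCRStructure

variable (S : AlmostCRStructure n M)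

/-- `V` is near `x` a `C^1` frame of the complex vector bundle `(D, J)`. The regularity is that
of the components in the chart of `M` at `x`. -/
structure IsFrameNear (x : M) (V : Fin n → ∀ y : M, S.D y) : Prop where
  contMDiffAt : ∀ i, ContMDiffAt (RModel n) 𝓘(ℝ, EuclideanSpace ℝ (Fin (2 * n + 1))) 1
    (fun y => (mfderiv (RModel n) 𝓘(ℝ, EuclideanSpace ℝ (Fin (2 * n + 1)))
      (extChartAt (RModel n) x) y (V i y) : EuclideanSpace ℝ (Fin (2 * n + 1)))) x
  span : ∀ᶠ y in 𝓝 x, Submodule.span ℝ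
    ((Set.range fun i => V i y) ∪ (Set.range fun i => S.J y (V i y))) = ⊤

/-- The map induced by a pencil on `M`. -/
def pencil (j : M → CPSpace N) (P₀ P₁ : MvPolynomial (Fin (N + 1)) ℂ) : M → CPSpace 1 :=
  fun y => pencilMap P₀ P₁ (j y)

/-- The base points in `M`. -/
def base (j : M → CPSpace N) (P₀ P₁ : MvPolynomial (Fin (N + 1)) ℂ) : Set M :=
  j ⁻¹' baseLocus P₀ P₁

/-- `φ` in the affine coordinate of the projective line around `φ x`. -/
def localCoord (φ : M → CPSpace 1) (x : M) : M → ℂ := fun y => lineCoord (φ x) (φ y)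

/-- The points of `M` outside the base where the derivative of `φ` along `D` vanishes. -/
def singularSet (j : M → CPSpace N) (P₀ P₁ : MvPolynomial (Fin (N + 1)) ℂ) : Set M :=
  {x | x ∉ base j P₀ P₁ ∧ ∀ v : S.D x, diffCP n (pencil j P₀ P₁) x v = 0}

/-- The CR 1-jet of `φ` is transversal along `D` at `x` to the jets with vanishing degree one
part. The bundle of CR 1-jets is trivialized by the affine coordinate of `ℂP^1` and by a local
complex frame `V` of `D`, so that the 1-jet of `φ` becomes `(c, (dc(V_i))_i)`, with `c` the
coordinate of `φ`. -/
def JetTransversalAlongD (φ : M → CPSpace 1) (x : M) : Prop :=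
  ∃ V : Fin n → ∀ y : M, S.D y, S.IsFrameNear x V ∧
    TransversalAlong (S.D x) (diffC n (localCoord φ x) x).toLinearMap
      (diffCm n (fun y i => diffC n (localCoord φ x) y (V i y)) x).toLinearMap

end AlmostCRStructure

/-- `TM^J`: the smallest complex subspace of the tangent space of projective space at `j x` that
contains the tangent space of `M` at `x`. -/
def complexEnvelope (n : ℕ) {M : Type*} [TopologicalSpace M]
    [ChartedSpace (EuclideanSpace ℝ (Fin (2 * n + 1))) M] (j : M → CPSpace N) (x : M) : Submodule ℂ (Fin N → ℂ) :=
  Submodule.span ℂ (Set.range (diffCP n j x))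

/-- `W` is near `x` a `C^1` frame of the complex vector bundle `TM^J` on `M`. The regularity is
that of the components in the chart of projective space at `j x`. -/
structure IsEnvelopeFrameNear (j : M → CPSpace N) (x : M)
    (W : Fin (n + 1) → M → (Fin N → ℂ)) : Prop where
  contMDiffAt : ∀ i, ContMDiffAt (RModel n) 𝓘(ℝ, Fin N → ℂ) 1
    (fun y => (mfderiv 𝓘(ℂ, Fin N → ℂ) 𝓘(ℂ, Fin N → ℂ)
      (chartAt (Fin N → ℂ) (j x)) (j y) (W i y) : Fin N → ℂ)) x
  span : ∀ᶠ y in 𝓝 x, LinearIndependent ℂ (fun i => W i y) ∧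
    Submodule.span ℂ (Set.range fun i => W i y) = complexEnvelope n j y

/-- The differential at `p` of `Φ`, in the affine coordinate of `ℂP^1` around `q`. -/
def pencilDiff (P₀ P₁ : MvPolynomial (Fin (N + 1)) ℂ) (q : CPSpace 1) (p : CPSpace N) :
    (Fin N → ℂ) →L[ℂ] ℂ :=
  mfderiv 𝓘(ℂ, Fin N → ℂ) 𝓘(ℂ, ℂ) (fun p' => lineCoord q (pencilMap P₀ P₁ p')) p

/-- The holomorphic 1-jet along `TM^J` of `Φ = [P₀ : P₁]` is transversal along `M` at `x` to the
jets with vanishing degree one part, in a trivialization as in `JetTransversalAlongD`. -/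
def JetTransversalAlongM (n : ℕ) {M : Type*} [TopologicalSpace M]
    [ChartedSpace (EuclideanSpace ℝ (Fin (2 * n + 1))) M] (j : M → CPSpace N) (P₀ P₁ : MvPolynomial (Fin (N + 1)) ℂ) (x : M) :
    Prop :=
  ∃ W : Fin (n + 1) → M → (Fin N → ℂ), IsEnvelopeFrameNear j x W ∧
    TransversalAlong (⊤ : Submodule ℝ (TangentSpace (RModel n) x))
      (diffC n (AlmostCRStructure.localCoord (AlmostCRStructure.pencil j P₀ P₁) x) x).toLinearMap
      (diffCm n (fun y i =>
        pencilDiff P₀ P₁ (pencilMap P₀ P₁ (j x)) (j y) (W i y)) x).toLinearMap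

/-- The pencil of degree `k` hypersurfaces spanned by `P₀` and `P₁` is a Lefschetz pencil
structure on `M`. -/
structure IsLefschetzPencil (S : AlmostCRStructure n M) (j : M → CPSpace N) (k : ℕ)
    (P₀ P₁ : MvPolynomial (Fin (N + 1)) ℂ) : Prop where
  isHomogeneous₀ : P₀.IsHomogeneous k
  isHomogeneous₁ : P₁.IsHomogeneous k
  linearIndependent : LinearIndependent ℂ ![P₀, P₁]
  /-- Any two different hypersurfaces of the pencil intersect transversally. -/
  transversal_members : ∀ a b c d : ℂ, a * d - b * c ≠ 0 →
    ∀ p ∈ zeroSet (a • P₀ + b • P₁) ∩ zeroSet (c • P₀ + d • P₁),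
      LinearIndependent ℂ ![diffAt (a • P₀ + b • P₁) p, diffAt (c • P₀ + d • P₁) p]
  /-- The base locus, with tangent space the kernel of the differentials of its two equations, is
  transversal to `M`. -/
  transversal_base : ∀ x ∈ AlmostCRStructure.base j P₀ P₁,
    (diffCP n j x).toLinearMap.range ⊔
      ((diffAt P₀ (j x)).ker ⊓ (diffAt P₁ (j x)).ker).restrictScalars ℝ = ⊤
  transversal_D : ∀ x ∉ AlmostCRStructure.base j P₀ P₁,
    (∀ v : S.D x, diffCP n (AlmostCRStructure.pencil j P₀ P₁) x v = 0) →
      S.JetTransversalAlongD (AlmostCRStructure.pencil j P₀ P₁) x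
  transversal_M : ∀ x ∉ AlmostCRStructure.base j P₀ P₁,
    (∀ w ∈ complexEnvelope n j x, pencilDiff P₀ P₁ (pencilMap P₀ P₁ (j x)) (j x) w = 0) →
      JetTransversalAlongM n j P₀ P₁ x

end

/-!
The normal forms are built from one supply of CR functions: holomorphic functions of the affine
coordinates of projective space, restricted to `M`.

*Charts.* Holomorphic functions that are independent on the complex subspace `j_* D x`, completed by
a local equation of the Levi foliation, are CR coordinates at `x`, by the inverse function theorem
(`AlmostCRStructure.exists_crChart`). In such coordinates a CR function of class `C^r` is a `C^r`
function on an open subset of `ℂ^n × ℝ` that is holomorphic on the slices `s = const`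
(`CRContDiffOn`, `AlmostCRStructure.IsCRChartAt.crContDiffOn_comp_symm`).

*Base points.* Transversality of the base locus says that the differentials of the two equations
map the real space `j_* T_x M`, of dimension `2n + 1`, onto `ℂ^2`. The image of the complex part
`j_* D x` is then a complex subspace of real codimension at most one, so it is all of `ℂ^2`
(`map_eq_top_of_surjective_of_finrank_le`). Hence `n ≥ 2`, and the two dehomogenized polynomials can
be taken as the first two CR coordinates; their quotient is the pencil in an affine chart.

*Singular points.* Let `f` be the pencil in an affine coordinate of the line, written in CR
coordinates. Leafwise derivatives of a CR function of class `C^r` are again of class `C^r`, by the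
Cauchy integral formula along the leaves (`CRContDiffOn.leafDeriv_crContDiffOn`), so no derivative
is lost in the equation of the critical points and in the Taylor remainder below. Transversality of
the CR 1-jet makes the leafwise Hessian nondegenerate
(`AlmostCRStructure.IsCRChartAt.injective_leafDeriv_leafDeriv`). Transversality of the holomorphic
1-jet implies `df ≠ 0` on `T_x M`, since otherwise it would make a real linear map from dimension
`2n + 1` to dimension `2n + 2` surjective (`IsLefschetzPencil.diffC_localCoord_ne_zero`). The
parametric Morse lemma (`CRContDiffOn.exists_morse_chart`) then applies: the critical points on the
leaves are moved to the axis `z = 0`, the second order Taylor remainder is a leafwise holomorphic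
family of symmetric forms, and a holomorphic square root brings this family to a constant form,
which is diagonalized. The critical values form the function `t`, and `t' (0) ≠ 0` because `df ≠ 0`
transversally to `D`.
-/

/-! ### Parametric integrals -/

section ParametricIntegral

open Set Filter MeasureTheory intervalIntegral

theorem exists_nhds_prod_uIcc_subset {E : Type*} [TopologicalSpace E] {O : Set (E × ℝ)}
    {a b : ℝ} (hO : IsOpen O) {p : E} (hp : ∀ θ ∈ uIcc a b, (p, θ) ∈ O) :
    ∃ s : Set E, IsOpen s ∧ p ∈ s ∧ ∀ q ∈ s, ∀ θ ∈ uIcc a b, (q, θ) ∈ O := by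
  obtain ⟨u, v, hu, -, hpu, hv, huv⟩ := generalized_tube_lemma (isCompact_singleton (x := p))
    (isCompact_uIcc (a := a) (b := b)) hO (by
      rintro ⟨q, θ⟩ ⟨hq, hθ⟩
      obtain rfl : q = p := hq
      exact hp θ hθ)
  exact ⟨u, hu, hpu rfl, fun q hq θ hθ => huv ⟨hq, hv hθ⟩⟩

variable {E F : Type} [NormedAddCommGroup E] [NormedSpace ℝ E]
  [NormedAddCommGroup F] [NormedSpace ℝ F] {O : Set (E × ℝ)} {U : Set E} {a b : ℝ}

theorem hasFDerivAt_intervalIntegral_of_contDiffOn {K : E × ℝ → F} (hO : IsOpen O)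
    (hK : ContDiffOn ℝ 1 K O) {p : E} (hp : ∀ θ ∈ uIcc a b, (p, θ) ∈ O) :
    HasFDerivAt (fun q => ∫ θ in a..b, K (q, θ))
      (∫ θ in a..b, (fderiv ℝ K (p, θ)).comp (ContinuousLinearMap.inl ℝ E ℝ)) p := by
  have hK' : ContinuousOn (fderiv ℝ K) O := hK.continuousOn_fderiv_of_isOpen hO le_rfl
  have hslice : ∀ q : E, Continuous fun θ : ℝ => (q, θ) := fun q => by fun_prop
  obtain ⟨C, hC⟩ := (isCompact_uIcc (a := a) (b := b)).exists_bound_of_continuousOn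
    (f := fun θ => fderiv ℝ K (p, θ)) (hK'.comp (hslice p).continuousOn hp)
  -- The derivative stays bounded on a tube around `{p} × [a, b]`.
  have hO' : IsOpen (O ∩ fderiv ℝ K ⁻¹' {L | ‖L‖ < C + 1}) :=
    hK'.isOpen_inter_preimage hO (isOpen_lt continuous_norm continuous_const)
  obtain ⟨s, hs, hps, hsO⟩ := exists_nhds_prod_uIcc_subset (a := a) (b := b) hO' (p := p)
    fun θ hθ => ⟨hp θ hθ, (hC θ hθ).trans_lt (lt_add_one C)⟩
  have hcont : ∀ q ∈ s, ContinuousOn (fun θ => K (q, θ)) (uIcc a b) := fun q hq =>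
    hK.continuousOn.comp (hslice q).continuousOn fun θ hθ => (hsO q hq θ hθ).1
  refine hasFDerivAt_integral_of_dominated_of_fderiv_le (𝕜 := ℝ)
    (F' := fun q θ => (fderiv ℝ K (q, θ)).comp (ContinuousLinearMap.inl ℝ E ℝ))
    (bound := fun _ => (C + 1) * ‖ContinuousLinearMap.inl ℝ E ℝ‖)
    (hs.mem_nhds hps) ?_ (hcont p hps).intervalIntegrable ?_ ?_ intervalIntegrable_const ?_
  · filter_upwards [hs.mem_nhds hps] with q hq
    exact ((hcont q hq).mono uIoc_subset_uIcc).aestronglyMeasurable measurableSet_uIoc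
  · refine ContinuousOn.aestronglyMeasurable ?_ measurableSet_uIoc
    exact ((hK'.comp (hslice p).continuousOn hp).mono uIoc_subset_uIcc).clm_comp continuousOn_const
  · refine Eventually.of_forall fun θ hθ q hq => ?_
    refine (ContinuousLinearMap.opNorm_comp_le _ _).trans ?_
    gcongr
    exact (hsO q hq θ (uIoc_subset_uIcc hθ)).2.le
  · refine Eventually.of_forall fun θ hθ q hq => ?_
    have h1 : HasFDerivAt K (fderiv ℝ K (q, θ)) (q, θ) :=
      ((hK.differentiableOn one_ne_zero).differentiableAt
        (hO.mem_nhds (hsO q hq θ (uIoc_subset_uIcc hθ)).1)).hasFDerivAt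
    exact h1.comp q (hasFDerivAt_prodMk_left q θ)

theorem contDiffOn_intervalIntegral_nat (m : ℕ) (hO : IsOpen O) (hU : IsOpen U)
    (hUO : ∀ p ∈ U, ∀ θ ∈ uIcc a b, (p, θ) ∈ O) :
    ∀ {F : Type} [NormedAddCommGroup F] [NormedSpace ℝ F] {K : E × ℝ → F},
      ContDiffOn ℝ m K O → ContDiffOn ℝ m (fun q => ∫ θ in a..b, K (q, θ)) U := by
  induction m with
  | zero =>
    intro F _ _ K hK
    refine contDiffOn_zero.2 fun p hp => ContinuousAt.continuousWithinAt ?_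
    have hK := hK.continuousOn
    have hslice : ∀ q : E, Continuous fun θ : ℝ => (q, θ) := fun q => by fun_prop
    obtain ⟨C, hC⟩ := (isCompact_uIcc (a := a) (b := b)).exists_bound_of_continuousOn
      (f := fun θ => K (p, θ)) (hK.comp (hslice p).continuousOn (hUO p hp))
    have hO' : IsOpen (O ∩ K ⁻¹' {L | ‖L‖ < C + 1}) :=
      hK.isOpen_inter_preimage hO (isOpen_lt continuous_norm continuous_const)
    obtain ⟨s, hs, hps, hsO⟩ := exists_nhds_prod_uIcc_subset (a := a) (b := b) hO' (p := p)
      fun θ hθ => ⟨hUO p hp θ hθ, (hC θ hθ).trans_lt (lt_add_one C)⟩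
    refine continuousAt_of_dominated_interval (bound := fun _ => C + 1) ?_ ?_
      intervalIntegrable_const ?_
    · filter_upwards [hs.mem_nhds hps] with q hq
      refine ContinuousOn.aestronglyMeasurable ?_ measurableSet_uIoc
      exact hK.comp (hslice q).continuousOn fun θ hθ => (hsO q hq θ (uIoc_subset_uIcc hθ)).1
    · filter_upwards [hs.mem_nhds hps] with q hq
      exact Eventually.of_forall fun θ hθ => (hsO q hq θ (uIoc_subset_uIcc hθ)).2.le
    · refine Eventually.of_forall fun θ hθ => ?_
      have : ContinuousAt K (p, θ) :=
        hK.continuousAt (hO.mem_nhds (hUO p hp θ (uIoc_subset_uIcc hθ)))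
      exact this.comp (f := fun q => (q, θ)) (by fun_prop)
  | succ m ih =>
    intro F _ _ K hK
    have hK1 : ContDiffOn ℝ 1 K O := hK.of_le (by exact_mod_cast Nat.le_add_left 1 m)
    have key := fun p hp => hasFDerivAt_intervalIntegral_of_contDiffOn hO hK1 (hUO p hp)
    have hm : ((m + 1 : ℕ) : ℕ∞ω) = (m : ℕ∞ω) + 1 := by norm_cast
    rw [hm] at hK ⊢
    refine (contDiffOn_succ_iff_hasFDerivWithinAt_of_uniqueDiffOn hU.uniqueDiffOn).2
      ⟨by simp, _, ?_, fun p hp => (key p hp).hasFDerivWithinAt⟩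
    exact ih (K := fun q => (fderiv ℝ K q).comp (ContinuousLinearMap.inl ℝ E ℝ))
      ((hK.fderiv_of_isOpen hO le_rfl).clm_comp contDiffOn_const)

theorem contDiffOn_intervalIntegral {r : ℕ∞} (hO : IsOpen O) (hU : IsOpen U)
    (hUO : ∀ p ∈ U, ∀ θ ∈ uIcc a b, (p, θ) ∈ O) {K : E × ℝ → F}
    (hK : ContDiffOn ℝ r K O) : ContDiffOn ℝ r (fun q => ∫ θ in a..b, K (q, θ)) U :=
  contDiffOn_iff_forall_nat_le.2 fun m hm =>
    contDiffOn_intervalIntegral_nat m hO hU hUO (hK.of_le (mod_cast hm))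

end ParametricIntegral

/-! ### The inverse function theorem of class `C^r` -/

/-- A map of class `C^r` near `a` with bijective derivative at `a` restricts to a
diffeomorphism of class `C^r` between open sets. -/
theorem exists_openPartialHomeomorph_of_bijective_fderiv {E F : Type*} [NormedAddCommGroup E]
    [NormedSpace ℝ E] [CompleteSpace E] [NormedAddCommGroup F] [NormedSpace ℝ F] [CompleteSpace F]
    {r : ℕ∞} (hr : 1 ≤ r) {f : E → F} {W : Set E} (hW : IsOpen W) (hf : ContDiffOn ℝ r f W)
    {a : E} (ha : a ∈ W) (hbij : Function.Bijective (fderiv ℝ f a)) :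
    ∃ e : OpenPartialHomeomorph E F, a ∈ e.source ∧ e.source ⊆ W ∧ (e : E → F) = f ∧
      ContDiffOn ℝ r e.symm e.target := by
  have hr1 : (1 : ℕ∞ω) ≤ (r : ℕ∞ω) := by exact_mod_cast hr
  have hr0 : (r : ℕ∞ω) ≠ 0 := fun h => by simp [h] at hr1
  let A : E ≃L[ℝ] F := ContinuousLinearEquiv.ofBijective (fderiv ℝ f a)
    (LinearMap.ker_eq_bot.2 hbij.1) (LinearMap.range_eq_top.2 hbij.2)
  have hA : fderiv ℝ f a = A := (ContinuousLinearEquiv.coe_ofBijective _ _ _).symm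
  have hfd : ∀ p ∈ W, HasFDerivAt f (fderiv ℝ f p) p := fun p hp =>
    ((hf.differentiableOn hr0).differentiableAt (hW.mem_nhds hp)).hasFDerivAt
  have hca : ContDiffAt ℝ r f a := hf.contDiffAt (hW.mem_nhds ha)
  let e₀ := hca.toOpenPartialHomeomorph f (hA ▸ hfd a ha) hr0
  -- Invertibility of the derivative is an open condition.
  have hopen : IsOpen (W ∩ fderiv ℝ f ⁻¹' Set.range ((↑) : (E ≃L[ℝ] F) → E →L[ℝ] F)) :=
    (hf.continuousOn_fderiv_of_isOpen hW hr1).isOpen_inter_preimage hW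
      ContinuousLinearEquiv.isOpen
  let e := e₀.restrOpen _ hopen
  have hsource : e.source = e₀.source ∩ _ := OpenPartialHomeomorph.restrOpen_source _ _ hopen
  refine ⟨e, ?_, ?_, rfl, ?_⟩
  · rw [hsource]
    exact ⟨hca.mem_toOpenPartialHomeomorph_source (hA ▸ hfd a ha) hr0, ha, A, hA.symm⟩
  · rw [hsource]
    exact fun p hp => hp.2.1
  · intro q hq
    have hq' := e.map_target hq
    rw [hsource] at hq'
    obtain ⟨-, hqW, B, hB⟩ := hq'
    exact (e.contDiffAt_symm hq (f₀' := B) (hB ▸ hfd _ hqW)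
      (hf.contDiffAt (hW.mem_nhds hqW))).contDiffWithinAt

/-! ### Functions holomorphic along the leaves of a linear foliation -/

section LeafwiseHolomorphic

set_option linter.unusedSectionVars false

open Set Filter MeasureTheory intervalIntegral

variable {V : Type*} [NormedAddCommGroup V] [NormedSpace ℂ V] [NormedSpace ℝ V]
  [IsScalarTower ℝ ℂ V]
  {Y Y' : Type} [NormedAddCommGroup Y] [NormedSpace ℝ Y] [NormedAddCommGroup Y'] [NormedSpace ℝ Y']
  {F G : Type} [NormedAddCommGroup F] [NormedSpace ℂ F] [NormedSpace ℝ F] [IsScalarTower ℝ ℂ F]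
  [NormedAddCommGroup G] [NormedSpace ℂ G] [NormedSpace ℝ G] [IsScalarTower ℝ ℂ G]
  {r : ℕ∞} {ι : V →L[ℝ] Y} {ι' : V →L[ℝ] Y'} {W : Set Y} {W' : Set Y'} {f : Y → F}

theorem complex_ofReal_smul {A : Type*} [AddCommGroup A] [Module ℂ A] [Module ℝ A]
    [IsScalarTower ℝ ℂ A] (t : ℝ) (w : A) : (t : ℂ) • w = t • w :=
  algebraMap_smul ℂ t w

/-- A real linear map between complex vector spaces that commutes with `I` is complex linear. -/
theorem map_complex_smul_of_map_I_smul {A B : Type*} [AddCommGroup A] [Module ℂ A] [Module ℝ A]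
    [IsScalarTower ℝ ℂ A] [AddCommGroup B] [Module ℂ B] [Module ℝ B] [IsScalarTower ℝ ℂ B]
    (L : A →ₗ[ℝ] B) (hL : ∀ v, L (Complex.I • v) = Complex.I • L v) (c : ℂ) (v : A) :
    L (c • v) = c • L v := by
  conv_lhs => rw [← Complex.re_add_im c]
  conv_rhs => rw [← Complex.re_add_im c]
  rw [add_smul, add_smul, mul_smul, mul_smul, map_add, complex_ofReal_smul, complex_ofReal_smul,
    complex_ofReal_smul, complex_ofReal_smul, map_smul, map_smul, hL]

/-- The space `Y` is foliated by the translates of the image of `ι : V → Y`. The function `f` is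
of class `C^r` on `W`, and its derivative along the leaves is complex linear for the complex
structure of `V`. -/
structure CRContDiffOn (ι : V →L[ℝ] Y) (r : ℕ∞) (f : Y → F) (W : Set Y) : Prop where
  contDiffOn : ContDiffOn ℝ r f W
  map_I_smul : ∀ p ∈ W, ∀ v, fderiv ℝ f p (ι (Complex.I • v)) = Complex.I • fderiv ℝ f p (ι v)

/-- The complex derivative of `f` along the leaf of the foliation by translates of the image of
`ι`. -/
noncomputable def leafDeriv (ι : V →L[ℝ] Y) (f : Y → F) (p : Y) : V →L[ℂ] F :=
  fderiv ℂ (fun v => f (p + ι v)) 0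

namespace CRContDiffOn

theorem mono {W₁ : Set Y} (hf : CRContDiffOn ι r f W) (h : W₁ ⊆ W) : CRContDiffOn ι r f W₁ :=
  ⟨hf.contDiffOn.mono h, fun p hp => hf.map_I_smul p (h hp)⟩

theorem differentiableAt (hr : 1 ≤ r) (hW : IsOpen W) (hf : CRContDiffOn ι r f W) {p : Y}
    (hp : p ∈ W) : DifferentiableAt ℝ f p := by
  refine (hf.contDiffOn.differentiableOn ?_).differentiableAt (hW.mem_nhds hp)
  exact_mod_cast (zero_lt_one.trans_le hr).ne'

theorem congr (hW : IsOpen W) (hf : CRContDiffOn ι r f W) {g : Y → F} (h : EqOn g f W) :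
    CRContDiffOn ι r g W := by
  refine ⟨hf.contDiffOn.congr h, fun p hp v => ?_⟩
  rw [(h.eventuallyEq_of_mem (hW.mem_nhds hp)).fderiv_eq]
  exact hf.map_I_smul p hp v

theorem map_smul (hf : CRContDiffOn ι r f W) {p : Y} (hp : p ∈ W) (c : ℂ) (v : V) :
    fderiv ℝ f p (ι (c • v)) = c • fderiv ℝ f p (ι v) :=
  map_complex_smul_of_map_I_smul ((fderiv ℝ f p).comp ι).toLinearMap (hf.map_I_smul p hp) c v

theorem hasFDerivAt_leafDeriv_zero (hr : 1 ≤ r) (hW : IsOpen W) (hf : CRContDiffOn ι r f W) {p : Y}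
    (hp : p ∈ W) : HasFDerivAt (fun v => f (p + ι v)) (leafDeriv ι f p) 0 := by
  let A : V →L[ℂ] F :=
    { toFun := fun v => fderiv ℝ f p (ι v)
      map_add' := fun v w => by simp
      map_smul' := fun c v => hf.map_smul hp c v
      cont := ((fderiv ℝ f p).comp ι).cont }
  have h1 : HasFDerivAt (fun v => f (p + ι v)) ((fderiv ℝ f p).comp ι) 0 := by
    have hd : HasFDerivAt f (fderiv ℝ f p) (p + ι 0) := by
      simpa using (hf.differentiableAt hr hW hp).hasFDerivAt
    exact hd.comp (0 : V) (ι.hasFDerivAt.const_add p)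
  have h2 : HasFDerivAt (𝕜 := ℂ) (fun v => f (p + ι v)) A 0 :=
    hasFDerivAt_of_restrictScalars ℝ h1 rfl
  exact h2.differentiableAt.hasFDerivAt

theorem leafDeriv_apply (hr : 1 ≤ r) (hW : IsOpen W) (hf : CRContDiffOn ι r f W) {p : Y}
    (hp : p ∈ W) (v : V) : leafDeriv ι f p v = fderiv ℝ f p (ι v) := by
  have h1 : HasFDerivAt (fun v => f (p + ι v)) ((fderiv ℝ f p).comp ι) 0 := by
    have hd : HasFDerivAt f (fderiv ℝ f p) (p + ι 0) := by
      simpa using (hf.differentiableAt hr hW hp).hasFDerivAt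
    exact hd.comp (0 : V) (ι.hasFDerivAt.const_add p)
  have h2 := (hf.hasFDerivAt_leafDeriv_zero hr hW hp).restrictScalars ℝ
  exact DFunLike.congr_fun (h2.unique h1) v

theorem hasFDerivAt_leafDeriv (hr : 1 ≤ r) (hW : IsOpen W) (hf : CRContDiffOn ι r f W) {p : Y}
    {w : V} (hp : p + ι w ∈ W) :
    HasFDerivAt (fun v => f (p + ι v)) (leafDeriv ι f (p + ι w)) w := by
  have h := hf.hasFDerivAt_leafDeriv_zero hr hW hp
  have h0 : (0 : V) = w - w := (sub_self w).symm
  rw [h0] at h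
  have := HasFDerivAt.comp (f := fun v : V => v - w) w h ((hasFDerivAt_id w).sub_const w)
  refine this.congr_of_eventuallyEq (Eventually.of_forall fun v => ?_)
  simp [add_assoc]

theorem comp_contDiffOn (hr : 1 ≤ r) (hW : IsOpen W) (hf : CRContDiffOn ι r f W) {H : F → G}
    {T : Set F} (hT : IsOpen T) (hH : ContDiffOn ℂ ω H T) (hfT : MapsTo f W T) :
    CRContDiffOn ι r (fun p => H (f p)) W := by
  refine ⟨((hH.restrict_scalars ℝ).of_le le_top).comp hf.contDiffOn hfT, fun p hp v => ?_⟩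
  have h1 : HasFDerivAt H (fderiv ℂ H (f p)) (f p) :=
    ((hH.differentiableOn (by simp)).differentiableAt (hT.mem_nhds (hfT hp))).hasFDerivAt
  have h2 := (h1.restrictScalars ℝ).comp p (hf.differentiableAt hr hW hp).hasFDerivAt
  have h3 : fderiv ℝ (fun p => H (f p)) p = _ := h2.fderiv
  simp [h3, hf.map_I_smul p hp]

theorem clm_comp (hr : 1 ≤ r) (hW : IsOpen W) (hf : CRContDiffOn ι r f W) (L : F →L[ℂ] G) :
    CRContDiffOn ι r (fun p => L (f p)) W :=
  hf.comp_contDiffOn hr hW isOpen_univ L.contDiff.contDiffOn (mapsTo_univ _ _)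

theorem prodMk (hr : 1 ≤ r) (hW : IsOpen W) (hf : CRContDiffOn ι r f W) {g : Y → G}
    (hg : CRContDiffOn ι r g W) : CRContDiffOn ι r (fun p => (f p, g p)) W := by
  refine ⟨hf.contDiffOn.prodMk hg.contDiffOn, fun p hp v => ?_⟩
  rw [(hf.differentiableAt hr hW hp).fderiv_prodMk (hg.differentiableAt hr hW hp)]
  simp [hf.map_I_smul p hp, hg.map_I_smul p hp]

theorem sum {κ : Type*} (s : Finset κ) (hr : 1 ≤ r) (hW : IsOpen W) {g : κ → Y → F}
    (hg : ∀ i, CRContDiffOn ι r (g i) W) : CRContDiffOn ι r (fun p => ∑ i ∈ s, g i p) W := by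
  refine ⟨ContDiffOn.sum fun i _ => (hg i).contDiffOn, fun p hp v => ?_⟩
  rw [fderiv_fun_sum fun i _ => (hg i).differentiableAt hr hW hp]
  simp [(hg _).map_I_smul p hp, Finset.smul_sum]

/-- Precomposition with a map of class `C^r` between foliated spaces that is conformal along the
leaves. -/
theorem comp_foliated (hr : 1 ≤ r) (hW : IsOpen W) (hf : CRContDiffOn ι r f W) {Θ : Y' → Y}
    (hΘ : ContDiffOn ℝ r Θ W') (hΘW : MapsTo Θ W' W)
    (hΘι : ∀ q ∈ W', ∃ Θ' : Y' →L[ℝ] Y, HasFDerivAt Θ Θ' q ∧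
      ∃ c : ℂ, ∀ v, Θ' (ι' v) = ι (c • v)) :
    CRContDiffOn ι' r (fun q => f (Θ q)) W' := by
  refine ⟨hf.contDiffOn.comp hΘ hΘW, fun q hq v => ?_⟩
  obtain ⟨Θ', hΘ', c, hc⟩ := hΘι q hq
  have h1 : fderiv ℝ (fun q => f (Θ q)) q = _ :=
    ((hf.differentiableAt hr hW (hΘW hq)).hasFDerivAt.comp q hΘ').fderiv
  simp only [h1, ContinuousLinearMap.comp_apply, hc, smul_comm c Complex.I v]
  exact hf.map_I_smul _ (hΘW hq) _

/-- Multiplication by a function that is constant along the leaves. -/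
theorem smul_of_fderiv_eq_zero (hr : 1 ≤ r) (hW : IsOpen W) (hf : CRContDiffOn ι r f W)
    {w : Y → ℂ} (hw : ContDiffOn ℝ r w W) (hwι : ∀ p ∈ W, ∀ v, fderiv ℝ w p (ι v) = 0) :
    CRContDiffOn ι r (fun p => w p • f p) W := by
  have hw' : CRContDiffOn ι r w W := ⟨hw, fun p hp v => by simp [hwι p hp]⟩
  refine ⟨hw.smul hf.contDiffOn, fun p hp v => ?_⟩
  have := (hw'.differentiableAt hr hW hp).hasFDerivAt.smul
    (hf.differentiableAt hr hW hp).hasFDerivAt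
  have h : fderiv ℝ (fun p => w p • f p) p = _ := this.fderiv
  simp [h, hwι p hp, hf.map_I_smul p hp]
  rw [smul_comm]

theorem intervalIntegral [CompleteSpace F] (hr : 1 ≤ r) {O : Set (Y × ℝ)} (hO : IsOpen O)
    (hW : IsOpen W) {a b : ℝ} (hWO : ∀ p ∈ W, ∀ θ ∈ uIcc a b, (p, θ) ∈ O) {K : Y × ℝ → F}
    (hK : CRContDiffOn ((ContinuousLinearMap.inl ℝ Y ℝ).comp ι) r K O) :
    CRContDiffOn ι r (fun p => ∫ θ in a..b, K (p, θ)) W := by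
  refine ⟨contDiffOn_intervalIntegral hO hW hWO hK.contDiffOn, fun p hp v => ?_⟩
  have hK1 : ContDiffOn ℝ 1 K O := hK.contDiffOn.of_le (by exact_mod_cast hr)
  have hint : IntervalIntegrable
      (fun θ => (fderiv ℝ K (p, θ)).comp (ContinuousLinearMap.inl ℝ Y ℝ)) volume a b := by
    refine ContinuousOn.intervalIntegrable ?_
    refine ContinuousOn.clm_comp ?_ continuousOn_const
    exact (hK1.continuousOn_fderiv_of_isOpen hO le_rfl).comp
      (Continuous.continuousOn (by fun_prop)) fun θ hθ => hWO p hp θ hθ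
  rw [(hasFDerivAt_intervalIntegral_of_contDiffOn hO hK1 (hWO p hp)).fderiv,
    ContinuousLinearMap.intervalIntegral_apply hint,
    ContinuousLinearMap.intervalIntegral_apply hint, ← intervalIntegral.integral_smul]
  exact integral_congr fun θ hθ => hK.map_I_smul (p, θ) (hWO p hp θ hθ) v

theorem of_locally (h : ∀ p ∈ W, ∃ U, IsOpen U ∧ p ∈ U ∧ CRContDiffOn ι r f U) :
    CRContDiffOn ι r f W := by
  refine ⟨fun p hp => ?_, fun p hp v => ?_⟩
  · obtain ⟨U, hU, hpU, hf⟩ := h p hp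
    exact (hf.contDiffOn.contDiffAt (hU.mem_nhds hpU)).contDiffWithinAt
  · obtain ⟨U, hU, hpU, hf⟩ := h p hp
    exact hf.map_I_smul p hpU v

end CRContDiffOn

/-- Cauchy's formula for the derivative, as an integral over the circle of radius `ε`. -/
theorem deriv_zero_eq_intervalIntegral [CompleteSpace F] {g : ℂ → F} {δ ε : ℝ} (hε : 0 < ε)
    (hεδ : ε < δ) (hg : DifferentiableOn ℂ g (Metric.ball 0 δ)) :
    deriv g 0 = (2 * Real.pi * Complex.I : ℂ)⁻¹ • ∫ θ in (0 : ℝ)..2 * Real.pi,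
      (Complex.I * (circleMap 0 ε θ)⁻¹) • g (circleMap 0 ε θ) := by
  -- Any real structure compatible with the complex one is the restriction of scalars.
  have hinst : ‹NormedSpace ℝ F› = NormedSpace.complexToReal := by
    ext t x
    exact (algebraMap_smul ℂ t x).symm
  subst hinst
  rw [← Complex.two_pi_I_inv_smul_circleIntegral_sub_sq_inv_smul_of_differentiable
    Metric.isOpen_ball (Metric.closedBall_subset_ball hεδ) hg (Metric.mem_ball_self hε)]
  congr 1
  refine integral_congr fun θ _ => ?_
  have h0 : circleMap 0 ε θ ≠ 0 := circleMap_ne_center hε.ne'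
  simp only [deriv_circleMap, sub_zero, smul_smul]
  congr 1
  field_simp

namespace CRContDiffOn

theorem leafDeriv_apply_crContDiffOn [CompleteSpace F] (hr : 1 ≤ r) (hW : IsOpen W)
    (hf : CRContDiffOn ι r f W) (v : V) :
    CRContDiffOn ι r (fun p => leafDeriv ι f p v) W := by
  refine of_locally fun p₀ hp₀ => ?_
  have hcont : Continuous fun q : Y × ℂ => q.1 + ι (q.2 • v) := by fun_prop
  have hnhds : (fun q : Y × ℂ => q.1 + ι (q.2 • v)) ⁻¹' W ∈ 𝓝 (p₀, (0 : ℂ)) :=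
    (hW.preimage hcont).mem_nhds (by simpa using hp₀)
  obtain ⟨δ, hδ, hball⟩ := Metric.mem_nhds_iff.1 hnhds
  rw [← ball_prod_same] at hball
  have hmem : ∀ p ∈ Metric.ball p₀ δ, ∀ ζ ∈ Metric.ball (0 : ℂ) δ, p + ι (ζ • v) ∈ W :=
    fun p hp ζ hζ => hball (show (p, ζ) ∈ _ from ⟨hp, hζ⟩)
  obtain ⟨ε, hε, hεδ⟩ := exists_between hδ
  have hne : ∀ θ, circleMap 0 ε θ ≠ 0 := fun θ => circleMap_ne_center hε.ne'
  have hcirc : ContDiff ℝ r (circleMap 0 ε) := contDiff_circleMap 0 ε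
  have hr0 : (r : ℕ∞ω) ≠ 0 := by exact_mod_cast (zero_lt_one.trans_le hr).ne'
  refine ⟨Metric.ball p₀ δ, Metric.isOpen_ball, Metric.mem_ball_self hδ, ?_⟩
  let O : Set (Y × ℝ) := (fun q => q.1 + ι (circleMap 0 ε q.2 • v)) ⁻¹' W
  have hΘ : ContDiff ℝ r (fun q : Y × ℝ => q.1 + ι (circleMap 0 ε q.2 • v)) := by
    have := hcirc.comp (contDiff_snd (E := Y) (F := ℝ))
    exact contDiff_fst.add (ι.contDiff.comp (this.smul contDiff_const))
  have hO : IsOpen O := hW.preimage hΘ.continuous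
  have hK1 : CRContDiffOn ((ContinuousLinearMap.inl ℝ Y ℝ).comp ι) r
      (fun q => f (q.1 + ι (circleMap 0 ε q.2 • v))) O := by
    refine hf.comp_foliated hr hW hΘ.contDiffOn (fun q hq => hq) fun q _ => ?_
    obtain ⟨c', hc'⟩ := ((hcirc.differentiable hr0) q.2)
    refine ⟨_, hasFDerivAt_fst.add (ι.hasFDerivAt.comp q
      ((hc'.comp q hasFDerivAt_snd).smul_const v)), 1, fun w => ?_⟩
    simp
  have hw : ContDiff ℝ r fun q : Y × ℝ => Complex.I * (circleMap 0 ε q.2)⁻¹ :=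
    contDiff_const.mul ((hcirc.comp contDiff_snd).inv fun q => hne q.2)
  have hK : CRContDiffOn ((ContinuousLinearMap.inl ℝ Y ℝ).comp ι) r
      (fun q => (Complex.I * (circleMap 0 ε q.2)⁻¹) • f (q.1 + ι (circleMap 0 ε q.2 • v))) O := by
    refine hK1.smul_of_fderiv_eq_zero hr hO hw.contDiffOn fun q _ w => ?_
    have h1 : DifferentiableAt ℝ (fun θ : ℝ => Complex.I * (circleMap 0 ε θ)⁻¹) q.2 :=
      ((contDiff_const.mul (hcirc.inv hne)).differentiable hr0) q.2
    have h2 : fderiv ℝ (fun q : Y × ℝ => Complex.I * (circleMap 0 ε q.2)⁻¹) q = _ :=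
      (h1.hasFDerivAt.comp q hasFDerivAt_snd).fderiv
    rw [h2]
    simp
  have hcm : ∀ θ, circleMap 0 ε θ ∈ Metric.ball (0 : ℂ) δ := fun θ => by
    simpa [abs_of_pos hε] using hεδ
  have hint := hK.intervalIntegral hr hO Metric.isOpen_ball (a := 0) (b := 2 * Real.pi)
    (W := Metric.ball p₀ δ) fun p hp θ _ => hmem p hp _ (hcm θ)
  refine (hint.clm_comp hr Metric.isOpen_ball
    ((2 * Real.pi * Complex.I : ℂ)⁻¹ • ContinuousLinearMap.id ℂ F)).congr Metric.isOpen_ball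
    fun p hp => ?_
  have hleaf : ∀ ζ ∈ Metric.ball (0 : ℂ) δ,
      HasDerivAt (fun ζ : ℂ => f (p + ι (ζ • v))) (leafDeriv ι f (p + ι (ζ • v)) v) ζ := by
    intro ζ hζ
    have h1 := hf.hasFDerivAt_leafDeriv hr hW (hmem p hp ζ hζ)
    have h2 : HasDerivAt (fun ζ : ℂ => ζ • v) v ζ := by
      simpa using (hasDerivAt_id ζ).smul_const v
    exact h1.comp_hasDerivAt ζ h2
  have h0 := (hleaf 0 (Metric.mem_ball_self hδ)).deriv
  simp only [zero_smul, map_zero, add_zero] at h0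
  have := deriv_zero_eq_intervalIntegral hε hεδ
    fun ζ hζ => (hleaf ζ hζ).differentiableAt.differentiableWithinAt
  simpa [← h0] using this

/-- The complex derivative along the leaves of a function of class `C^r` that is holomorphic along
the leaves is again of class `C^r`: Cauchy's formula expresses it by integrals of the function
itself. -/
theorem leafDeriv_crContDiffOn {V : Type} [NormedAddCommGroup V] [NormedSpace ℂ V]
    [NormedSpace ℝ V] [IsScalarTower ℝ ℂ V] {ι : V →L[ℝ] Y} [FiniteDimensional ℂ V]
    [CompleteSpace F] (hr : 1 ≤ r) (hW : IsOpen W) (hf : CRContDiffOn ι r f W) :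
    CRContDiffOn ι r (leafDeriv ι f) W := by
  let b := Module.finBasis ℂ V
  have h : leafDeriv ι f = fun p => ∑ k, ContinuousLinearMap.smulRightL ℂ V F
      (LinearMap.toContinuousLinearMap (b.coord k)) (leafDeriv ι f p (b k)) := by
    funext p
    ext w
    have h := congrArg (leafDeriv ι f p) (b.sum_repr w).symm
    rw [map_sum] at h
    simpa using h
  rw [h]
  exact sum _ hr hW fun k => (hf.leafDeriv_apply_crContDiffOn hr hW (b k)).clm_comp hr hW _

theorem leafDeriv_leafDeriv_symm {V : Type} [NormedAddCommGroup V] [NormedSpace ℂ V]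
    [NormedSpace ℝ V] [IsScalarTower ℝ ℂ V] {ι : V →L[ℝ] Y} [FiniteDimensional ℂ V]
    [CompleteSpace F] (hr : 1 ≤ r) (hW : IsOpen W) (hf : CRContDiffOn ι r f W) {p : Y}
    (hp : p ∈ W) (v w : V) :
    leafDeriv ι (leafDeriv ι f) p v w = leafDeriv ι (leafDeriv ι f) p w v := by
  have hnhds : ∀ᶠ v in 𝓝 (0 : V), p + ι v ∈ W := by
    refine (hW.preimage (by fun_prop : Continuous fun v : V => p + ι v)).mem_nhds ?_
    simpa using hp
  refine second_derivative_symmetric_of_eventually (f := fun v => f (p + ι v)) (x := 0)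
    (f' := fun v => leafDeriv ι f (p + ι v)) ?_
    ((hf.leafDeriv_crContDiffOn hr hW).hasFDerivAt_leafDeriv_zero hr hW hp) v w
  filter_upwards [hnhds] with v hv
  exact hf.hasFDerivAt_leafDeriv hr hW hv

end CRContDiffOn

end LeafwiseHolomorphic

/-! ### Square roots and diagonalization of symmetric forms -/

section SquareRoot

open Set Filter

/-- Near `1`, a complex subspace of a finite-dimensional algebra that is closed under squaring has a
holomorphic square root. -/
theorem exists_holomorphic_sqrt {A : Type*} [NormedRing A] [NormedAlgebra ℂ A]
    [FiniteDimensional ℂ A] (S : Submodule ℂ A) (h1 : (1 : A) ∈ S) (hsq : ∀ y ∈ S, y * y ∈ S) :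
    ∃ (T : Set S) (σ : S → S), IsOpen T ∧ (⟨1, h1⟩ : S) ∈ T ∧ ContDiffOn ℂ ω σ T ∧
      σ ⟨1, h1⟩ = ⟨1, h1⟩ ∧ ∀ x ∈ T, (σ x : A) * (σ x : A) = x := by
  have : CompleteSpace S := FiniteDimensional.complete ℂ S
  obtain ⟨π₀, hπ₀⟩ := S.subtype.exists_leftInverse_of_injective (Submodule.ker_subtype S)
  let π : A →L[ℂ] S := LinearMap.toContinuousLinearMap π₀
  have hπ : ∀ y (hy : y ∈ S), π y = ⟨y, hy⟩ := fun y hy => DFunLike.congr_fun hπ₀ ⟨y, hy⟩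
  let one : S := ⟨1, h1⟩
  let sq : S → S := fun y => π ((y : A) * (y : A))
  have hsqv : ∀ y : S, (sq y : A) = (y : A) * (y : A) := fun y => by
    simp only [sq]
    rw [hπ _ (hsq y y.2)]
  have hval : ContDiff ℂ ω (fun y : S => (y : A)) := S.subtypeL.contDiff
  have hcd : ContDiff ℂ ω sq := π.contDiff.comp (hval.mul hval)
  let D : S ≃L[ℂ] S := (LinearEquiv.smulOfNeZero ℂ S (2 : ℂ) two_ne_zero).toContinuousLinearEquiv
  have hD : HasFDerivAt sq (D : S →L[ℂ] S) one := by
    have hv : HasFDerivAt (fun y : S => (y : A)) S.subtypeL one := S.subtypeL.hasFDerivAt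
    have := π.hasFDerivAt.comp one (hv.mul' hv)
    refine this.congr_fderiv ?_
    ext y
    have hy := hπ y y.2
    simp [one, D, hy, two_smul]
  have hone : sq one = one := Subtype.ext (by rw [hsqv]; simp [one])
  let e := hcd.contDiffAt.toOpenPartialHomeomorph sq hD (by simp)
  have hes : one ∈ e.source := hcd.contDiffAt.mem_toOpenPartialHomeomorph_source hD (by simp)
  have het : one ∈ e.target := by
    have := e.map_source hes
    rwa [show e one = one from hone] at this
  have hsymm : e.symm one = one := by
    have := e.left_inv hes
    rwa [show e one = one from hone] at this
  have hc : ContDiffAt ℂ ω e.symm one := by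
    refine e.contDiffAt_symm het (f₀' := D) ?_ ?_
    · rw [hsymm]; exact hD
    · exact hcd.contDiffAt
  obtain ⟨T, hT, hTo, hT1⟩ := eventually_nhds_iff.1
    ((hc.eventually (by simp)).and (e.open_target.mem_nhds het))
  refine ⟨T, e.symm, hTo, hT1, fun x hx => (hT x hx).1.contDiffWithinAt, hsymm, fun x hx => ?_⟩
  rw [← hsqv]
  exact congrArg Subtype.val (e.right_inv (hT x hx).2)

/-- A nondegenerate symmetric complex bilinear form is a sum of squares in suitable linear
coordinates. -/
theorem exists_linearEquiv_sum_sq {V : Type*} [NormedAddCommGroup V] [NormedSpace ℂ V]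
    [FiniteDimensional ℂ V] {n : ℕ} (hn : Module.finrank ℂ V = n) (β : V →L[ℂ] V →L[ℂ] ℂ)
    (hsymm : ∀ v w, β v w = β w v) (hinj : Function.Injective β) :
    ∃ R : V ≃ₗ[ℂ] (Fin n → ℂ), ∀ w, β w w = ∑ i, R w i ^ 2 := by
  subst hn
  let B : LinearMap.BilinForm ℂ V := LinearMap.mk₂ ℂ (fun v w => β v w) (by simp) (by simp)
    (by simp) (by simp)
  have hassoc : QuadraticMap.associated (R := ℂ) B.toQuadraticMap = B :=
    QuadraticMap.associated_left_inverse ℂ fun v w => hsymm v w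
  have hsep : LinearMap.SeparatingLeft (QuadraticMap.associated (R := ℂ) B.toQuadraticMap) := by
    rw [hassoc]
    intro v hv
    refine hinj ?_
    rw [map_zero]
    ext w
    exact hv w
  obtain ⟨R⟩ := QuadraticForm.equivalent_weightedSumSquares_of_isAlgClosed B.toQuadraticMap hsep
  refine ⟨R.toLinearEquiv, fun w => ?_⟩
  have h : B.toQuadraticMap w = β w w := rfl
  rw [← h, ← R.map_app w, QuadraticMap.weightedSumSquares_apply]
  simp [sq]

end SquareRoot

/-! ### The Morse lemma with a real parameter -/

section Morse

open Set Filter MeasureTheory intervalIntegral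

variable {V : Type} [NormedAddCommGroup V] [NormedSpace ℂ V] [NormedSpace ℝ V]
  [IsScalarTower ℝ ℂ V] [FiniteDimensional ℂ V]
  {Y : Type} [NormedAddCommGroup Y] [NormedSpace ℝ Y]
  {F : Type} [NormedAddCommGroup F] [NormedSpace ℂ F] [NormedSpace ℝ F] [IsScalarTower ℝ ℂ F]
  {r : ℕ∞}

/-- Taylor's formula of order two along a leaf, with integral remainder. -/
theorem CRContDiffOn.taylor_two [CompleteSpace F] {ι : V →L[ℝ] Y} {W : Set Y} {f : Y → F}
    (hr : 1 ≤ r) (hW : IsOpen W) (hf : CRContDiffOn ι r f W) {p : Y} {v : V}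
    (hseg : ∀ u ∈ uIcc (0 : ℝ) 1, p + ι (u • v) ∈ W) :
    f (p + ι v) = f p + leafDeriv ι f p v +
      (∫ u in (0 : ℝ)..1, (1 - u : ℝ) • leafDeriv ι (leafDeriv ι f) (p + ι (u • v))) v v := by
  have hf1 := hf.leafDeriv_crContDiffOn hr hW
  have hf2 := hf1.leafDeriv_crContDiffOn hr hW
  have hcont : ContinuousOn (fun u : ℝ => (1 - u : ℝ) • leafDeriv ι (leafDeriv ι f) (p + ι (u • v)))
      (uIcc 0 1) := by
    have hc : ContinuousOn (fun u : ℝ => 1 - u) (uIcc 0 1) := by fun_prop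
    exact hc.smul (hf2.contDiffOn.continuousOn.comp
      (by fun_prop : Continuous fun u : ℝ => p + ι (u • v)).continuousOn hseg)
  have hint := hcont.intervalIntegrable (μ := volume)
  have hcont' : ContinuousOn
      (fun u : ℝ => ((1 - u : ℝ) • leafDeriv ι (leafDeriv ι f) (p + ι (u • v))) v) (uIcc 0 1) :=
    hcont.clm_apply continuousOn_const
  have hcont'' : ContinuousOn
      (fun u : ℝ => ((1 - u : ℝ) • leafDeriv ι (leafDeriv ι f) (p + ι (u • v))) v v) (uIcc 0 1) :=
    hcont'.clm_apply continuousOn_const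
  have hline : ∀ u : ℝ, HasDerivAt (fun u : ℝ => u • v) v u := fun u => by
    simpa using (hasDerivAt_id u).smul_const v
  -- The integrand is the derivative of `u ↦ (1 - u) φ'(u) + φ(u)` for `φ(u) = f (p + u v)`.
  have hderiv : ∀ u ∈ uIcc (0 : ℝ) 1, HasDerivAt
      (fun u : ℝ => (1 - u) • leafDeriv ι f (p + ι (u • v)) v + f (p + ι (u • v)))
      (((1 - u : ℝ) • leafDeriv ι (leafDeriv ι f) (p + ι (u • v))) v v) u := by
    intro u hu
    have h0 := ((hf.hasFDerivAt_leafDeriv hr hW (hseg u hu)).restrictScalars ℝ).comp_hasDerivAt u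
      (hline u)
    have h1 := ((hf1.hasFDerivAt_leafDeriv hr hW (hseg u hu)).restrictScalars ℝ).comp_hasDerivAt u
      (hline u)
    have h2 := (((ContinuousLinearMap.apply ℂ F v).restrictScalars ℝ).hasFDerivAt).comp_hasDerivAt u
      h1
    refine ((((hasDerivAt_id u).const_sub 1).smul h2).add h0).congr_deriv ?_
    simp
  have hFTC := integral_eq_sub_of_hasDerivAt hderiv hcont''.intervalIntegrable
  rw [ContinuousLinearMap.intervalIntegral_apply hint,
    ContinuousLinearMap.intervalIntegral_apply hcont'.intervalIntegrable, hFTC]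
  simp only [sub_self, zero_smul, one_smul, map_zero, add_zero, zero_add, sub_zero]
  abel

/-- A function that is holomorphic along the leaves `V × {s}`, with invertible derivative along the
leaf through `p₀`, is together with `s` a diffeomorphism near `p₀`. -/
theorem CRContDiffOn.exists_foliated_chart [FiniteDimensional ℂ F] (hr : 1 ≤ r) {W : Set (V × ℝ)}
    (hW : IsOpen W) {g : V × ℝ → F} (hg : CRContDiffOn (ContinuousLinearMap.inl ℝ V ℝ) r g W)
    {p₀ : V × ℝ} (hp₀ : p₀ ∈ W)
    (hbij : Function.Bijective (leafDeriv (ContinuousLinearMap.inl ℝ V ℝ) g p₀)) :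
    ∃ e : OpenPartialHomeomorph (V × ℝ) (F × ℝ), p₀ ∈ e.source ∧ e.source ⊆ W ∧
      (e : V × ℝ → F × ℝ) = (fun p => (g p, p.2)) ∧ ContDiffOn ℝ r e.symm e.target := by
  have : CompleteSpace V := FiniteDimensional.complete ℂ V
  have : CompleteSpace F := FiniteDimensional.complete ℂ F
  refine exists_openPartialHomeomorph_of_bijective_fderiv hr hW
    (hg.contDiffOn.prodMk contDiff_snd.contDiffOn) hp₀ ?_
  have hd := hg.differentiableAt hr hW hp₀
  have hfd : fderiv ℝ (fun p : V × ℝ => (g p, p.2)) p₀ = _ :=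
    (hd.hasFDerivAt.prodMk hasFDerivAt_snd).fderiv
  have hval : ∀ v τ, fderiv ℝ g p₀ (v, τ) =
      leafDeriv (ContinuousLinearMap.inl ℝ V ℝ) g p₀ v + fderiv ℝ g p₀ (0, τ) := fun v τ => by
    rw [hg.leafDeriv_apply hr hW hp₀, ← map_add]
    simp
  rw [hfd]
  constructor
  · rintro ⟨v, τ⟩ ⟨v', τ'⟩ h
    simp only [ContinuousLinearMap.prod_apply, ContinuousLinearMap.coe_snd', Prod.mk.injEq] at h
    obtain ⟨h1, rfl⟩ := h
    rw [hval, hval v'] at h1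
    rw [hbij.1 (add_right_cancel h1)]
  · rintro ⟨w, τ⟩
    obtain ⟨v, hv⟩ := hbij.2 (w - fderiv ℝ g p₀ (0, τ))
    refine ⟨(v, τ), ?_⟩
    simp [hval v, hv]

/-- The Morse lemma for a family `f (·, s)` of holomorphic functions that has a nondegenerate
critical point at `0` for every `s`. -/
theorem CRContDiffOn.exists_sum_sq_of_critical (hr : 1 ≤ r) {n : ℕ}
    (hn : Module.finrank ℂ V = n) {ρ : ℝ} (hρ : 0 < ρ) {f : V × ℝ → ℂ}
    (hf : CRContDiffOn (ContinuousLinearMap.inl ℝ V ℝ) r f (Metric.ball 0 ρ))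
    (hcrit : ∀ s : ℝ, (0, s) ∈ Metric.ball (0 : V × ℝ) ρ →
      leafDeriv (ContinuousLinearMap.inl ℝ V ℝ) f (0, s) = 0)
    (hnd : Function.Injective (leafDeriv (ContinuousLinearMap.inl ℝ V ℝ)
      (leafDeriv (ContinuousLinearMap.inl ℝ V ℝ) f) 0)) :
    ∃ (W : Set (V × ℝ)) (ζ : V × ℝ → (Fin n → ℂ)), IsOpen W ∧ 0 ∈ W ∧
      CRContDiffOn (ContinuousLinearMap.inl ℝ V ℝ) r ζ W ∧
      Function.Bijective (leafDeriv (ContinuousLinearMap.inl ℝ V ℝ) ζ 0) ∧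
      (∀ s, ζ (0, s) = 0) ∧ ∀ p ∈ W, f p = f (0, p.2) + ∑ i, ζ p i ^ 2 := by
  have : CompleteSpace V := FiniteDimensional.complete ℂ V
  set ι := ContinuousLinearMap.inl ℝ V ℝ with hι
  set β := leafDeriv ι (leafDeriv ι f) 0 with hβ
  have hB : IsOpen (Metric.ball (0 : V × ℝ) ρ) := Metric.isOpen_ball
  have h0B : (0 : V × ℝ) ∈ Metric.ball (0 : V × ℝ) ρ := Metric.mem_ball_self hρ
  have hf1 := hf.leafDeriv_crContDiffOn hr hB
  have hf2 := hf1.leafDeriv_crContDiffOn hr hB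
  -- The segment from `(0, s)` to `(z, s)` stays in the ball.
  have hseg : ∀ p ∈ Metric.ball (0 : V × ℝ) ρ, ∀ u ∈ uIcc (0 : ℝ) 1,
      (u • p.1, p.2) ∈ Metric.ball (0 : V × ℝ) ρ := by
    intro p hp u hu
    rw [uIcc_of_le zero_le_one] at hu
    rw [mem_ball_zero_iff, Prod.norm_def, max_lt_iff] at hp ⊢
    refine ⟨?_, hp.2⟩
    rw [norm_smul, Real.norm_of_nonneg hu.1]
    exact (mul_le_of_le_one_left (norm_nonneg _) hu.2).trans_lt hp.1
  let K : (V × ℝ) × ℝ → V →L[ℂ] V →L[ℂ] ℂ := fun q =>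
    ((1 - q.2 : ℝ) : ℂ) • leafDeriv ι (leafDeriv ι f) (q.2 • q.1.1, q.1.2)
  let A : V × ℝ → V →L[ℂ] V →L[ℂ] ℂ := fun p => ∫ u in (0 : ℝ)..1, K (p, u)
  have hA : CRContDiffOn ι r A (Metric.ball 0 ρ) := by
    have hΘ : ContDiff ℝ r (fun q : (V × ℝ) × ℝ => (q.2 • q.1.1, q.1.2)) := by fun_prop
    have hO := hB.preimage hΘ.continuous
    refine CRContDiffOn.intervalIntegral hr hO hB (fun p hp u hu => hseg p hp u hu) ?_
    refine smul_of_fderiv_eq_zero hr hO ?_ ?_ ?_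
    · refine hf2.comp_foliated hr hB hΘ.contDiffOn (fun q hq => hq) fun q _ => ?_
      refine ⟨_, (hasFDerivAt_snd.smul hasFDerivAt_fst.fst).prodMk hasFDerivAt_fst.snd,
        (q.2 : ℂ), fun v => ?_⟩
      simp [hι, -Complex.coe_smul, complex_ofReal_smul]
    · refine ContDiff.contDiffOn ?_
      exact Complex.ofRealCLM.contDiff.comp (contDiff_const.sub contDiff_snd)
    · intro q _ v
      have : HasFDerivAt (fun q : (V × ℝ) × ℝ => ((1 - q.2 : ℝ) : ℂ)) _ q :=
        Complex.ofRealCLM.hasFDerivAt.comp q (hasFDerivAt_snd.const_sub 1)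
      rw [this.fderiv]
      simp
  have hKcont : ∀ p ∈ Metric.ball (0 : V × ℝ) ρ,
      ContinuousOn (fun u => K (p, u)) (uIcc (0 : ℝ) 1) := by
    intro p hp
    have hc : ContinuousOn (fun u : ℝ => ((1 - u : ℝ) : ℂ)) (uIcc 0 1) := by fun_prop
    have hl : ContinuousOn (fun u : ℝ => (u • p.1, p.2)) (uIcc 0 1) := by fun_prop
    exact hc.smul (hf2.contDiffOn.continuousOn.comp hl fun u hu => hseg p hp u hu)
  have hAsymm : ∀ p ∈ Metric.ball (0 : V × ℝ) ρ, ∀ v w, A p v w = A p w v := by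
    intro p hp v w
    have hev : ∀ v w : V, A p v w = ∫ u in (0 : ℝ)..1, K (p, u) v w := by
      intro v w
      rw [ContinuousLinearMap.intervalIntegral_apply (hKcont p hp).intervalIntegrable,
        ContinuousLinearMap.intervalIntegral_apply
          ((hKcont p hp).clm_apply continuousOn_const).intervalIntegrable]
    rw [hev, hev]
    refine integral_congr fun u hu => ?_
    simp only [K, smul_apply]
    rw [hf.leafDeriv_leafDeriv_symm hr hB (hseg p hp u hu)]
  have hKreal : ∀ q, K q = (1 - q.2 : ℝ) • leafDeriv ι (leafDeriv ι f) (q.2 • q.1.1, q.1.2) :=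
    fun q => complex_ofReal_smul (1 - q.2) (leafDeriv ι (leafDeriv ι f) (q.2 • q.1.1, q.1.2))
  have hA0 : (2 : ℂ) • A 0 = β := by
    have hA0' : A 0 = ∫ u in (0 : ℝ)..1, (1 - u : ℝ) • β := by
      refine integral_congr fun u _ => ?_
      simp only [hKreal, hβ, Prod.fst_zero, Prod.snd_zero, smul_zero, ← Prod.zero_eq_mk]
    have h2 : ∫ u in (0 : ℝ)..1, (1 - u : ℝ) = 1 / 2 := by
      rw [intervalIntegral.integral_sub (by simp) (by simp)]
      norm_num [integral_id]
    rw [hA0', intervalIntegral.integral_smul_const, h2, ← complex_ofReal_smul, smul_smul]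
    norm_num
  have hTaylor : ∀ p ∈ Metric.ball (0 : V × ℝ) ρ, f p = f (0, p.2) + A p p.1 p.1 := by
    intro p hp
    have h0s : (0, p.2) ∈ Metric.ball (0 : V × ℝ) ρ := by simpa using hseg p hp 0 (by simp)
    have hline : ∀ v : V, (0, p.2) + ι v = (v, p.2) := fun v => by simp [hι]
    have := hf.taylor_two hr hB (p := (0, p.2)) (v := p.1) fun u hu => by
      rw [hline]
      exact hseg p hp u hu
    simp only [hcrit _ h0s, hline, zero_apply, add_zero] at this
    simpa only [A, hKreal] using this
  have hβsymm : ∀ v w, β v w = β w v := fun v w => hf.leafDeriv_leafDeriv_symm hr hB h0B v w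
  obtain ⟨R, hR⟩ := exists_linearEquiv_sum_sq hn ((2 : ℂ)⁻¹ • β)
    (fun v w => by simp [hβsymm v w]) fun v w hvw => hnd
      (smul_right_injective _ (inv_ne_zero (two_ne_zero' ℂ)) hvw)
  have hfin : Module.finrank ℂ V = Module.finrank ℂ (V →L[ℂ] ℂ) := by
    rw [← (LinearMap.toContinuousLinearMap (𝕜 := ℂ) (E := V) (F' := ℂ)).finrank_eq]
    exact (Subspace.dual_finrank_eq (K := ℂ) (V := V)).symm
  let B : V ≃L[ℂ] (V →L[ℂ] ℂ) :=
    (LinearEquiv.ofInjectiveOfFinrankEq β.toLinearMap hnd hfin).toContinuousLinearEquiv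
  have hBβ : ∀ v, B v = β v := fun v => rfl
  -- `X p` represents the form `2 A p` by an endomorphism, with respect to `β`.
  let X : V × ℝ → V →L[ℂ] V := fun p =>
    (ContinuousLinearMap.compL ℂ V (V →L[ℂ] ℂ) V (B.symm : (V →L[ℂ] ℂ) →L[ℂ] V)) ((2 : ℂ) • A p)
  have hXβ : ∀ p v, β (X p v) = (2 : ℂ) • A p v := fun p v => by
    rw [← hBβ]
    simp [X]
  have hX : CRContDiffOn ι r X (Metric.ball 0 ρ) :=
    hA.clm_comp hr hB ((2 : ℂ) • ContinuousLinearMap.compL ℂ V (V →L[ℂ] ℂ) V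
      (B.symm : (V →L[ℂ] ℂ) →L[ℂ] V)) |>.congr hB fun p _ => by simp [X]
  have hX0 : X 0 = 1 := by
    ext v
    refine hnd ?_
    rw [hXβ, ← smul_apply, hA0]
    rfl
  -- The endomorphisms that are self-adjoint with respect to `β`.
  let S : Submodule ℂ (V →L[ℂ] V) :=
    { carrier := {y | ∀ v w, β (y v) w = β (y w) v}
      add_mem' := fun {x y} hx hy v w => by simp [hx v w, hy v w]
      zero_mem' := fun v w => by simp
      smul_mem' := fun c x hx v w => by simp [hx v w] }
  have hXS : ∀ p ∈ Metric.ball (0 : V × ℝ) ρ, X p ∈ S := fun p hp v w => by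
    simp [hXβ, hAsymm p hp v w]
  obtain ⟨T, σ, hT, h1T, hσ, hσ1, hσsq⟩ := exists_holomorphic_sqrt S (fun v w => hβsymm v w)
    fun y hy v w => by
      change β (y (y v)) w = β (y (y w)) v
      rw [hy (y v) w, hy (y w) v, hβsymm]
  obtain ⟨π₀, hπ₀⟩ := S.subtype.exists_leftInverse_of_injective (Submodule.ker_subtype S)
  let π : (V →L[ℂ] V) →L[ℂ] S := LinearMap.toContinuousLinearMap π₀
  have hπ : ∀ y (hy : y ∈ S), π y = ⟨y, hy⟩ := fun y hy => DFunLike.congr_fun hπ₀ ⟨y, hy⟩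
  have hπX : CRContDiffOn ι r (fun p => π (X p)) (Metric.ball 0 ρ) := by
    exact CRContDiffOn.clm_comp (G := S) hr hB hX π
  let W : Set (V × ℝ) := Metric.ball 0 ρ ∩ (fun p => π (X p)) ⁻¹' T
  have hW : IsOpen W := hπX.contDiffOn.continuousOn.isOpen_inter_preimage hB hT
  have hπ0 : π (X 0) = ⟨1, fun v w => hβsymm v w⟩ := by
    rw [hπ _ (hXS 0 h0B)]
    exact Subtype.ext hX0
  have h0W : (0 : V × ℝ) ∈ W := ⟨h0B, by rw [mem_preimage, hπ0]; exact h1T⟩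
  let Q : V × ℝ → V →L[ℂ] V := fun p => (σ (π (X p)) : V →L[ℂ] V)
  have hQ : CRContDiffOn ι r Q W :=
    ((hπX.mono inter_subset_left).comp_contDiffOn hr hW hT hσ fun p hp => hp.2).clm_comp hr hW
      S.subtypeL
  have hQ0 : Q 0 = 1 := by
    simp only [Q, hπ0, hσ1]
  have hQX : ∀ p ∈ W, ∀ v, Q p (Q p v) = X p v := fun p hp v => by
    have hval : (π (X p) : V →L[ℂ] V) = X p := by rw [hπ _ (hXS p hp.1)]
    exact DFunLike.congr_fun ((hσsq _ hp.2).trans hval) v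
  have hfst : CRContDiffOn ι r (Prod.fst : V × ℝ → V) W := by
    refine ⟨contDiff_fst.contDiffOn, fun p _ v => ?_⟩
    simp [hι, fderiv_fst]
  let Rc : V →L[ℂ] (Fin n → ℂ) := LinearMap.toContinuousLinearMap R.toLinearMap
  let ζ : V × ℝ → (Fin n → ℂ) := fun p => Rc (Q p p.1)
  have hζ : CRContDiffOn ι r ζ W := by
    refine CRContDiffOn.clm_comp hr hW ?_ Rc
    exact (hQ.prodMk hr hW hfst).comp_contDiffOn hr hW isOpen_univ
      (H := fun q : (V →L[ℂ] V) × V => q.1 q.2)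
      (contDiff_fst.clm_apply contDiff_snd).contDiffOn (mapsTo_univ _ _)
  have hζ' : leafDeriv ι ζ 0 = Rc := by
    have hd := (hQ.hasFDerivAt_leafDeriv_zero hr hW h0W).clm_apply
      ((hfst.hasFDerivAt_leafDeriv_zero hr hW h0W))
    have hd2 := (Rc.hasFDerivAt.comp (0 : V) hd).fderiv
    change fderiv ℂ (fun v => Rc (Q (0 + ι v) (0 + ι v).1)) 0 = Rc
    have hfst0 : leafDeriv ι (Prod.fst : V × ℝ → V) 0 = ContinuousLinearMap.id ℂ V := by
      ext v
      rw [hfst.leafDeriv_apply hr hW h0W, fderiv_fst]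
      rfl
    refine hd2.trans ?_
    simp only [map_zero, add_zero, hQ0, hfst0, Prod.fst_zero]
    ext1 v
    simp
  refine ⟨W, ζ, hW, h0W, hζ, ?_, fun s => by simp [ζ], fun p hp => ?_⟩
  · rw [hζ']
    exact R.bijective
  · rw [hTaylor p hp.1, add_right_inj]
    have h1 : A p p.1 p.1 = ((2 : ℂ)⁻¹ • β) (Q p p.1) (Q p p.1) := by
      have hS : Q p ∈ S := (σ (π (X p))).2
      have : β (Q p p.1) (Q p p.1) = (2 : ℂ) • A p p.1 p.1 := by
        rw [← hS, hQX p hp, hXβ]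
        rfl
      simp [this]
    rw [h1, hR]
    rfl

/-- The Morse lemma with a real parameter: near a point where the leafwise derivative of `f`
vanishes nondegenerately, `f` is the sum of the squares of leafwise holomorphic coordinates and of
a function `t` of the parameter. -/
theorem CRContDiffOn.exists_morse_chart (hr : 1 ≤ r) {n : ℕ}
    (hn : Module.finrank ℂ V = n) {W : Set (V × ℝ)} (hW : IsOpen W) (h0W : 0 ∈ W) {f : V × ℝ → ℂ}
    (hf : CRContDiffOn (ContinuousLinearMap.inl ℝ V ℝ) r f W)
    (hcrit : leafDeriv (ContinuousLinearMap.inl ℝ V ℝ) f 0 = 0)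
    (hnd : Function.Injective (leafDeriv (ContinuousLinearMap.inl ℝ V ℝ)
      (leafDeriv (ContinuousLinearMap.inl ℝ V ℝ) f) 0))
    (hs : fderiv ℝ f 0 (0, 1) ≠ 0) :
    ∃ (ζ : V × ℝ → (Fin n → ℂ)) (e : OpenPartialHomeomorph (V × ℝ) ((Fin n → ℂ) × ℝ)) (t : ℝ → ℂ),
      0 ∈ e.source ∧ e.source ⊆ W ∧ e 0 = 0 ∧ (e : V × ℝ → (Fin n → ℂ) × ℝ) = (fun p => (ζ p, p.2)) ∧
      CRContDiffOn (ContinuousLinearMap.inl ℝ V ℝ) r ζ e.source ∧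
      ContDiffOn ℝ r e.symm e.target ∧ ContDiffOn ℝ r t (Prod.snd '' e.target) ∧
      t 0 = 0 ∧ deriv t 0 ≠ 0 ∧ ∀ p ∈ e.source, f p = f 0 + (∑ i, ζ p i ^ 2 + t p.2) := by
  have : CompleteSpace V := FiniteDimensional.complete ℂ V
  set ι := ContinuousLinearMap.inl ℝ V ℝ with hι
  have hr0 : (r : ℕ∞ω) ≠ 0 := by exact_mod_cast (zero_lt_one.trans_le hr).ne'
  have hg := hf.leafDeriv_crContDiffOn hr hW
  have hfin : Module.finrank ℂ V = Module.finrank ℂ (V →L[ℂ] ℂ) := by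
    rw [← (LinearMap.toContinuousLinearMap (𝕜 := ℂ) (E := V) (F' := ℂ)).finrank_eq]
    exact (Subspace.dual_finrank_eq (K := ℂ) (V := V)).symm
  have hbij : Function.Bijective (leafDeriv ι (leafDeriv ι f) 0) :=
    ⟨hnd, (LinearMap.injective_iff_surjective_of_finrank_eq_finrank
      (f := (leafDeriv ι (leafDeriv ι f) 0).toLinearMap) hfin).1 hnd⟩
  -- The critical points of `f (·, s)` are parametrized by `s ↦ c s`.
  obtain ⟨e₁, h0e₁, he₁W, he₁, he₁symm⟩ := hg.exists_foliated_chart hr hW h0W hbij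
  have he₁0 : e₁ 0 = 0 := by simp [he₁, hcrit]
  let J : Set ℝ := (fun s : ℝ => ((0 : V →L[ℂ] ℂ), s)) ⁻¹' e₁.target
  have hJ : IsOpen J := e₁.open_target.preimage (by fun_prop)
  have h0J : (0 : ℝ) ∈ J := by
    have := e₁.map_source h0e₁
    rwa [he₁0] at this
  let c : ℝ → V := fun s => (e₁.symm (0, s)).1
  have hcs : ∀ s ∈ J, e₁.symm (0, s) = (c s, s) := by
    intro s hs
    have h1 := e₁.right_inv hs
    rw [he₁] at h1
    exact Prod.ext rfl (by simpa using congrArg Prod.snd h1)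
  have hcW : ∀ s ∈ J, (c s, s) ∈ W := fun s hs => by
    rw [← hcs s hs]
    exact he₁W (e₁.map_target hs)
  have hc0 : c 0 = 0 := by
    have : e₁.symm (e₁ 0) = 0 := e₁.left_inv h0e₁
    rw [he₁0] at this
    exact congrArg Prod.fst this
  have hgc : ∀ s ∈ J, leafDeriv ι f (c s, s) = 0 := by
    intro s hs
    have h1 := e₁.right_inv hs
    rw [hcs s hs, he₁] at h1
    exact congrArg Prod.fst h1
  have hc : ContDiffOn ℝ r c J := by
    have h2 : ContDiff ℝ r (fun s : ℝ => ((0 : V →L[ℂ] ℂ), s)) := contDiff_const.prodMk contDiff_id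
    exact contDiff_fst.comp_contDiffOn (he₁symm.comp h2.contDiffOn fun s hs => hs)
  have hcd : ∀ s ∈ J, DifferentiableAt ℝ c s := fun s hs =>
    (hc.differentiableOn hr0).differentiableAt (hJ.mem_nhds hs)
  -- Translations along the leaves, by `± c s`.
  let Θ : ℂ → V × ℝ → V × ℝ := fun a p => (p.1 + a • c p.2, p.2)
  let D : Set (V × ℝ) := Prod.snd ⁻¹' J
  have hD : IsOpen D := hJ.preimage continuous_snd
  have hΘ : ∀ a, ContDiffOn ℝ r (Θ a) D := by
    intro a
    have h1 : ContDiffOn ℝ r (fun p : V × ℝ => c p.2) D :=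
      hc.comp contDiff_snd.contDiffOn fun p hp => hp
    exact (contDiff_fst.contDiffOn.add (contDiffOn_const.smul h1)).prodMk contDiff_snd.contDiffOn
  have hΘι : ∀ a, ∀ q ∈ D, ∃ Θ' : V × ℝ →L[ℝ] V × ℝ, HasFDerivAt (Θ a) Θ' q ∧
      ∃ b : ℂ, ∀ v, Θ' (ι v) = ι (b • v) := by
    intro a q hq
    have h1 : HasFDerivAt (fun p : V × ℝ => c p.2) _ q :=
      (hcd q.2 hq).hasFDerivAt.comp q hasFDerivAt_snd
    exact ⟨_, (hasFDerivAt_fst.add (h1.const_smul a)).prodMk hasFDerivAt_snd, 1, fun v => by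
      simp [hι]⟩
  have hΘleaf : ∀ {F : Type} [NormedAddCommGroup F] [NormedSpace ℂ F] (k : V × ℝ → F) a p,
      leafDeriv ι (fun q => k (Θ a q)) p = leafDeriv ι k (Θ a p) := by
    intro F _ _ k a p
    simp only [leafDeriv]
    congr 1
    funext v
    simp only [Θ, hι]
    congr 1
    ext1
    · simp [add_right_comm]
    · simp
  have hΘ0 : ∀ a, Θ a 0 = 0 := fun a => by simp [Θ, hc0]
  have hD0 : (0 : V × ℝ) ∈ D := h0J
  have hW₂ : IsOpen (D ∩ Θ 1 ⁻¹' W) := (hΘ 1).continuousOn.isOpen_inter_preimage hD hW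
  obtain ⟨ρ, hρ, hball⟩ := Metric.isOpen_iff.1 hW₂ 0 ⟨hD0, by simpa [hΘ0] using h0W⟩
  have hf' : CRContDiffOn ι r (fun p => f (Θ 1 p)) (Metric.ball 0 ρ) :=
    (hf.comp_foliated hr hW ((hΘ 1).mono inter_subset_left) (fun p hp => hp.2)
      fun q hq => hΘι 1 q hq.1).mono hball
  obtain ⟨W₃, ζ, hW₃, h0W₃, hζ, hζbij, hζ0, hζf⟩ := hf'.exists_sum_sq_of_critical hr hn hρ
    (fun s hs => by
      rw [hΘleaf]
      simpa [Θ] using hgc s (hball hs).1)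
    (by
      have h1 : leafDeriv ι (fun p => f (Θ 1 p)) = fun p => leafDeriv ι f (Θ 1 p) :=
        funext fun p => hΘleaf f 1 p
      rw [← hι, h1, hΘleaf, hΘ0]
      exact hnd)
  have hW₄ : IsOpen (D ∩ Θ (-1) ⁻¹' W₃ ∩ W) :=
    ((hΘ (-1)).continuousOn.isOpen_inter_preimage hD hW₃).inter hW
  have h0W₄ : 0 ∈ D ∩ Θ (-1) ⁻¹' W₃ ∩ W := ⟨⟨hD0, by simpa [hΘ0] using h0W₃⟩, h0W⟩
  have hζ' : CRContDiffOn ι r (fun p => ζ (Θ (-1) p)) (D ∩ Θ (-1) ⁻¹' W₃ ∩ W) :=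
    (hζ.comp_foliated hr hW₃ ((hΘ (-1)).mono inter_subset_left) (fun p hp => hp.2)
      fun q hq => hΘι (-1) q hq.1).mono inter_subset_left
  obtain ⟨e, h0e, heW, he, hesymm⟩ := hζ'.exists_foliated_chart hr hW₄ h0W₄ (by
    rw [← hι, hΘleaf, hΘ0]
    exact hζbij)
  have hsnd : Prod.snd '' e.target ⊆ J := by
    rintro _ ⟨q, hq, rfl⟩
    have h1 := (heW (e.map_target hq)).1.1
    have h2 := congrArg Prod.snd (e.right_inv hq)
    rw [he] at h2
    rw [← h2]
    exact h1
  have hcurve : ContDiffOn ℝ r (fun s => (c s, s)) J := hc.prodMk contDiff_id.contDiffOn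
  refine ⟨fun p => ζ (Θ (-1) p), e, fun s => f (c s, s) - f 0, h0e, fun p hp => (heW hp).2, ?_, he,
    hζ'.mono heW, hesymm, ?_, ?_, ?_, fun p hp => ?_⟩
  · rw [he]
    simp only [hΘ0]
    exact Prod.ext (hζ0 0) rfl
  · exact ((hf.contDiffOn.comp hcurve hcW).sub contDiffOn_const).mono hsnd
  · simp [hc0, ← Prod.zero_eq_mk]
  · have h1 : HasDerivAt (fun s => (c s, s)) (deriv c 0, (1 : ℝ)) 0 :=
      (hcd 0 h0J).hasDerivAt.prodMk (hasDerivAt_id 0)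
    have h2 : HasFDerivAt f (fderiv ℝ f 0) (c 0, 0) := by
      rw [hc0]
      exact (hf.differentiableAt hr hW h0W).hasFDerivAt
    have h3 := ((HasFDerivAt.comp_hasDerivAt (f := fun s => (c s, s)) 0 h2 h1).sub_const (f 0)).deriv
    have h4 : fderiv ℝ f 0 (deriv c 0, 1) = fderiv ℝ f 0 (0, 1) := by
      have h5 := hf.leafDeriv_apply hr hW h0W (deriv c 0)
      rw [hcrit] at h5
      have h6 : ((deriv c 0, 1) : V × ℝ) = ι (deriv c 0) + (0, 1) := by simp [hι]
      rw [h6, map_add, ← h5]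
      simp
    rw [h4] at h3
    exact fun h => hs (h3.symm.trans h)
  · have h1 := hζf _ (heW hp).1.2
    have h2 : Θ 1 (Θ (-1) p) = p := by simp [Θ]
    have h3 : Θ 1 (0, (Θ (-1) p).2) = (c p.2, p.2) := by simp [Θ]
    rw [h2, h3] at h1
    rw [h1]
    ring

end Morse

/-! ### Pencils in affine coordinates -/

namespace CPSpace

variable {N : ℕ}

/-- The dehomogenization of `P` with respect to the `i`-th homogeneous coordinate, as a function
of the affine coordinates. -/
noncomputable def dehom (i : Fin (N + 1)) (P : MvPolynomial (Fin (N + 1)) ℂ) (u : Fin N → ℂ) : ℂ :=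
  MvPolynomial.eval (i.insertNth (1 : ℂ) u : Fin (N + 1) → ℂ) P

theorem contDiff_dehom (i : Fin (N + 1)) (P : MvPolynomial (Fin (N + 1)) ℂ) :
    ContDiff ℂ ω (dehom i P) := by
  have h1 : ContDiff ℂ ω fun v : Fin (N + 1) → ℂ => MvPolynomial.eval v P :=
    contDiffOn_univ.1 ((AnalyticOnNhd.eval_mvPolynomial P).contDiffOn uniqueDiffOn_univ)
  have h2 : ContDiff ℂ ω fun u : Fin N → ℂ => (i.insertNth (1 : ℂ) u : Fin (N + 1) → ℂ) := by
    refine contDiff_pi.2 fun l => Fin.succAboveCases i ?_ (fun k => ?_) l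
    · simpa using contDiff_const
    · simpa using contDiff_apply ℂ ℂ k
  exact h1.comp h2

theorem _root_.MvPolynomial.IsHomogeneous.eval_smul {σ R : Type*} [CommSemiring R]
    {P : MvPolynomial σ R} {k : ℕ} (hP : P.IsHomogeneous k) (c : R) (v : σ → R) :
    MvPolynomial.eval (c • v) P = c ^ k * MvPolynomial.eval v P := by
  rw [MvPolynomial.eval_eq, MvPolynomial.eval_eq, Finset.mul_sum]
  refine Finset.sum_congr rfl fun d hd => ?_
  have hdk : ∑ i ∈ d.support, d i = k := by
    rw [← Finsupp.degree_apply, Finsupp.degree_eq_weight_one]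
    exact hP (MvPolynomial.mem_support_iff.1 hd)
  simp only [Pi.smul_apply, smul_eq_mul, mul_pow, Finset.prod_mul_distrib, Finset.prod_pow_eq_pow_sum,
    hdk]
  ring

theorem eval_rep_eq {P : MvPolynomial (Fin (N + 1)) ℂ} {k : ℕ} (hP : P.IsHomogeneous k)
    {i : Fin (N + 1)} {p : CPSpace N} (hp : p.rep i ≠ 0) :
    MvPolynomial.eval p.rep P = p.rep i ^ k * dehom i P (affineCoord i p) := by
  rw [dehom, ← hP.eval_smul]
  congr 2
  funext l
  refine Fin.succAboveCases i ?_ (fun m => ?_) l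
  · simp
  · simp [affineCoord, mul_div_cancel₀ _ hp]

theorem eval_rep_eq_zero_iff {P : MvPolynomial (Fin (N + 1)) ℂ} {k : ℕ} (hP : P.IsHomogeneous k)
    {i : Fin (N + 1)} {p : CPSpace N} (hp : p.rep i ≠ 0) :
    MvPolynomial.eval p.rep P = 0 ↔ dehom i P (affineCoord i p) = 0 := by
  simp [eval_rep_eq hP hp, hp]

variable {P₀ P₁ : MvPolynomial (Fin (N + 1)) ℂ}

theorem pencilMap_of_notMem_baseLocus {p : CPSpace N} (hp : p ∉ baseLocus P₀ P₁) :
    ∃ h, pencilMap P₀ P₁ p =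
      Projectivization.mk ℂ ![MvPolynomial.eval p.rep P₀, MvPolynomial.eval p.rep P₁] h := by
  have h : (![MvPolynomial.eval p.rep P₀, MvPolynomial.eval p.rep P₁] : Fin 2 → ℂ) ≠ 0 := by
    intro h
    exact hp ⟨congrFun h 0, congrFun h 1⟩
  exact ⟨h, dif_neg h⟩

theorem notMem_baseLocus_of_eval_ne_zero {b : Fin 2} {p : CPSpace N}
    (h : MvPolynomial.eval p.rep (![P₀, P₁] b) ≠ 0) : p ∉ baseLocus P₀ P₁ := by
  rintro ⟨h0, h1⟩
  fin_cases b
  · exact h h0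
  · exact h h1

theorem pencilMap_rep_ne_zero_iff {p : CPSpace N} (hp : p ∉ baseLocus P₀ P₁) (b : Fin 2) :
    (pencilMap P₀ P₁ p).rep b ≠ 0 ↔ MvPolynomial.eval p.rep (![P₀, P₁] b) ≠ 0 := by
  obtain ⟨h, hmk⟩ := pencilMap_of_notMem_baseLocus hp
  rw [hmk, rep_mk_apply_ne_zero_iff]
  fin_cases b <;> rfl

theorem affineCoord_pencilMap {k : ℕ} (h₀ : P₀.IsHomogeneous k) (h₁ : P₁.IsHomogeneous k)
    {p : CPSpace N} (hp : p ∉ baseLocus P₀ P₁) {i : Fin (N + 1)} (hi : p.rep i ≠ 0) (b : Fin 2) :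
    affineCoord b (pencilMap P₀ P₁ p) 0 =
      dehom i (![P₀, P₁] (b.succAbove 0)) (affineCoord i p) /
        dehom i (![P₀, P₁] b) (affineCoord i p) := by
  obtain ⟨h, hmk⟩ := pencilMap_of_notMem_baseLocus hp
  have hk : p.rep i ^ k ≠ 0 := pow_ne_zero k hi
  rw [hmk, affineCoord_mk]
  have hev : ∀ c : Fin 2, (![MvPolynomial.eval p.rep P₀, MvPolynomial.eval p.rep P₁] : Fin 2 → ℂ) c
      = p.rep i ^ k * dehom i (![P₀, P₁] c) (affineCoord i p) := by
    intro c
    fin_cases c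
    · exact eval_rep_eq h₀ hi
    · exact eval_rep_eq h₁ hi
  simp only [hev]
  exact mul_div_mul_left _ _ hk

end CPSpace

/-! ### Differentials on manifolds of dimension `2n + 1` -/

section Differentials

variable {n : ℕ} {M : Type*} [TopologicalSpace M]
  [ChartedSpace (EuclideanSpace ℝ (Fin (2 * n + 1))) M]
  {F G : Type*} [NormedAddCommGroup F] [NormedSpace ℝ F] [NormedAddCommGroup G] [NormedSpace ℝ G]

/-- The differential at `x` of a map to a normed space. -/
noncomputable def diffV (n : ℕ) {M : Type*} [TopologicalSpace M]
    [ChartedSpace (EuclideanSpace ℝ (Fin (2 * n + 1))) M] {F : Type*} [NormedAddCommGroup F]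
    [NormedSpace ℝ F] (c : M → F) (x : M) : TangentSpace (RModel n) x →L[ℝ] F :=
  mfderiv (RModel n) 𝓘(ℝ, F) c x

theorem diffV_comp {c : M → F} {x : M} {g : F → G} (hg : DifferentiableAt ℝ g (c x))
    (hc : MDifferentiableAt (RModel n) 𝓘(ℝ, F) c x) (v : TangentSpace (RModel n) x) :
    diffV n (fun y => g (c y)) x v = fderiv ℝ g (c x) (diffV n c x v) := by
  have h := (HasMFDerivAt.comp x hg.hasFDerivAt.hasMFDerivAt hc.hasMFDerivAt).mfderiv
  exact DFunLike.congr_fun h v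

theorem mdifferentiableAt_comp {c : M → F} {x : M} {g : F → G} (hg : DifferentiableAt ℝ g (c x))
    (hc : MDifferentiableAt (RModel n) 𝓘(ℝ, F) c x) :
    MDifferentiableAt (RModel n) 𝓘(ℝ, G) (fun y => g (c y)) x :=
  (HasMFDerivAt.comp x hg.hasFDerivAt.hasMFDerivAt hc.hasMFDerivAt).mdifferentiableAt

theorem diffV_congr {c c' : M → F} {x : M} (h : c =ᶠ[𝓝 x] c') : diffV n c x = diffV n c' x :=
  h.mfderiv_eq

theorem diffV_eq_fderiv {c : M → F} {x : M} (hc : MDifferentiableAt (RModel n) 𝓘(ℝ, F) c x) :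
    diffV n c x = fderiv ℝ (c ∘ (chartAt (EuclideanSpace ℝ (Fin (2 * n + 1))) x).symm)
      (chartAt (EuclideanSpace ℝ (Fin (2 * n + 1))) x x) := by
  let L : EuclideanSpace ℝ (Fin (2 * n + 1)) →L[ℝ] F := diffV n c x
  have h : HasFDerivWithinAt (c ∘ (chartAt (EuclideanSpace ℝ (Fin (2 * n + 1))) x).symm) L
      (Set.range (RModel n)) (chartAt (EuclideanSpace ℝ (Fin (2 * n + 1))) x x) :=
    hc.hasMFDerivAt.2
  rw [ModelWithCorners.range_eq_univ, hasFDerivWithinAt_univ] at h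
  exact h.fderiv.symm

/-- A map of class `C^r` near `a` with bijective differential at `a` restricts to a
diffeomorphism of class `C^r` between open sets. -/
theorem exists_openPartialHomeomorph_of_bijective_diffV [CompleteSpace F] {r : ℕ∞} (hr : 1 ≤ r)
    [IsManifold (RModel n) r M] {f : M → F} {U : Set M} (hU : IsOpen U)
    (hf : ContMDiffOn (RModel n) 𝓘(ℝ, F) r f U) {a : M} (ha : a ∈ U)
    (hbij : Function.Bijective (diffV n f a)) :
    ∃ e : OpenPartialHomeomorph M F, a ∈ e.source ∧ e.source ⊆ U ∧ Set.EqOn e f e.source ∧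
      ContMDiffOn (RModel n) 𝓘(ℝ, F) r e e.source ∧
      ContMDiffOn 𝓘(ℝ, F) (RModel n) r e.symm e.target := by
  have hr0 : (r : ℕ∞ω) ≠ 0 := by exact_mod_cast (zero_lt_one.trans_le hr).ne'
  set φ := chartAt (EuclideanSpace ℝ (Fin (2 * n + 1))) a with hφ
  have hφsymm : ContMDiffOn (RModel n) (RModel n) r φ.symm φ.target := contMDiffOn_chart_symm
  have hW : IsOpen (φ.target ∩ φ.symm ⁻¹' U) :=
    φ.symm.isOpen_inter_preimage hU
  have hcd : ContDiffOn ℝ r (f ∘ φ.symm) (φ.target ∩ φ.symm ⁻¹' U) := by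
    rw [← contMDiffOn_iff_contDiffOn]
    exact hf.comp (hφsymm.mono Set.inter_subset_left) fun q hq => hq.2
  have hasrc : a ∈ φ.source := mem_chart_source _ a
  have haW : φ a ∈ φ.target ∩ φ.symm ⁻¹' U :=
    ⟨φ.map_source hasrc, by rw [Set.mem_preimage, φ.left_inv hasrc]; exact ha⟩
  have hfa : MDifferentiableAt (RModel n) 𝓘(ℝ, F) f a :=
    (hf.contMDiffAt (hU.mem_nhds ha)).mdifferentiableAt hr0
  obtain ⟨e, hae, heW, hef, hesymm⟩ := exists_openPartialHomeomorph_of_bijective_fderiv hr hW hcd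
    haW (by rw [← diffV_eq_fderiv hfa]; exact hbij)
  have hsub : (φ.trans e).source ⊆ U := by
    intro y hy
    rw [OpenPartialHomeomorph.trans_source] at hy
    have := (heW hy.2).2
    rwa [Set.mem_preimage, φ.left_inv hy.1] at this
  have heq : Set.EqOn (φ.trans e) f (φ.trans e).source := by
    intro y hy
    rw [OpenPartialHomeomorph.trans_source] at hy
    simp [hef, φ.left_inv hy.1]
  refine ⟨φ.trans e, ?_, hsub, heq, (hf.mono hsub).congr heq, ?_⟩
  · rw [OpenPartialHomeomorph.trans_source]
    exact ⟨hasrc, hae⟩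
  · rw [OpenPartialHomeomorph.trans_target]
    exact hφsymm.comp (contMDiffOn_iff_contDiffOn.2 (hesymm.mono Set.inter_subset_left))
      fun q hq => hq.2

end Differentials

/-! ### CR maps from affine coordinates -/

section CRMaps

open CPSpace

variable {n N : ℕ} {M : Type*} [TopologicalSpace M]
  [ChartedSpace (EuclideanSpace ℝ (Fin (2 * n + 1))) M]

/-- The map `j` in the preferred affine chart of projective space around `j x`. -/
noncomputable def affineLift (j : M → CPSpace N) (x : M) : M → (Fin N → ℂ) :=
  fun y => affineCoord (index (j x)) (j y)

/-- The points whose image under `j` lies in the preferred affine chart around `j x`. -/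
def affineDomain {M : Type*} (j : M → CPSpace N) (x : M) : Set M :=
  {y | (j y).rep (index (j x)) ≠ 0}

variable {S : AlmostCRStructure n M} {h : ℕ∞} {j : M → CPSpace N}

theorem mem_affineDomain_self {M : Type*} (j : M → CPSpace N) (x : M) : x ∈ affineDomain j x :=
  rep_index_ne_zero (j x)

theorem isOpen_affineDomain (hj : Continuous j) (x : M) : IsOpen (affineDomain j x) :=
  (isOpen_rep_ne_zero _).preimage hj

theorem contMDiffOn_affineLift (hj : ContMDiff (RModel n) 𝓘(ℝ, Fin N → ℂ) h j) (x : M) :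
    ContMDiffOn (RModel n) 𝓘(ℝ, Fin N → ℂ) h (affineLift j x) (affineDomain j x) :=
  (contMDiffOn_chart (I := 𝓘(ℝ, Fin N → ℂ)) (x := j x)).comp hj.contMDiffOn fun _ hy => hy

theorem diffV_affineLift_self {x : M}
    (hj : MDifferentiableAt (RModel n) 𝓘(ℝ, Fin N → ℂ) j x) :
    diffV n (affineLift j x) x = diffCP n j x := by
  have h1 := hj.hasMFDerivAt
  have h2 : HasMFDerivAt (RModel n) 𝓘(ℝ, Fin N → ℂ) (affineLift j x) x (diffCP n j x) := by
    refine ⟨?_, h1.2⟩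
    exact ((continuousOn_affineCoord (index (j x))).continuousAt
      ((isOpen_rep_ne_zero _).mem_nhds (rep_index_ne_zero (j x)))).comp h1.1
  exact h2.mfderiv

theorem hasMFDerivAt_restrictScalars {F : Type*} [NormedAddCommGroup F] [NormedSpace ℂ F]
    [NormedSpace ℝ F] [IsScalarTower ℝ ℂ F] {c : CPSpace N → F} {p : CPSpace N}
    {T : (Fin N → ℂ) →L[ℂ] F} (hc : HasMFDerivAt 𝓘(ℂ, Fin N → ℂ) 𝓘(ℂ, F) c p T) :
    HasMFDerivAt 𝓘(ℝ, Fin N → ℂ) 𝓘(ℝ, F) c p (T.restrictScalars ℝ) := by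
  refine ⟨hc.1, ?_⟩
  have h2 : HasFDerivWithinAt (𝕜 := ℂ) (E := Fin N → ℂ) (F := F)
      (c ∘ (chartAt (Fin N → ℂ) p).symm) T (Set.range 𝓘(ℂ, Fin N → ℂ))
      (chartAt (Fin N → ℂ) p p) := hc.2
  rw [ModelWithCorners.range_eq_univ, hasFDerivWithinAt_univ] at h2
  exact (h2.restrictScalars ℝ).hasFDerivWithinAt

theorem diffV_comp_CPSpace {F : Type*} [NormedAddCommGroup F] [NormedSpace ℂ F]
    [NormedSpace ℝ F] [IsScalarTower ℝ ℂ F] {c : CPSpace N → F} {x : M}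
    {T : (Fin N → ℂ) →L[ℂ] F} (hc : HasMFDerivAt 𝓘(ℂ, Fin N → ℂ) 𝓘(ℂ, F) c (j x) T)
    (hj : MDifferentiableAt (RModel n) 𝓘(ℝ, Fin N → ℂ) j x) (v : TangentSpace (RModel n) x) :
    diffV n (fun y => c (j y)) x v = T (diffCP n j x v) := by
  have h := (HasMFDerivAt.comp x (hasMFDerivAt_restrictScalars hc) hj.hasMFDerivAt).mfderiv
  exact DFunLike.congr_fun h v

namespace AlmostCRStructure.IsCREmbedding

theorem mdifferentiableAt (hh : 1 ≤ h) (hj : S.IsCREmbedding h j) (x : M) :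
    MDifferentiableAt (RModel n) 𝓘(ℝ, Fin N → ℂ) j x :=
  hj.contMDiff.contMDiffAt.mdifferentiableAt
    (by exact_mod_cast (zero_lt_one.trans_le hh).ne')

/-- In affine coordinates, the differential of a CR embedding is complex linear on `D`. -/
theorem diffV_affineLift_J (hh : 1 ≤ h) (hj : S.IsCREmbedding h j) {x y : M}
    (hy : y ∈ affineDomain j x) (v : S.D y) :
    diffV n (affineLift j x) y (S.J y v) = Complex.I • diffV n (affineLift j x) y v := by
  have hκ : MDifferentiableAt 𝓘(ℂ, Fin N → ℂ) 𝓘(ℂ, Fin N → ℂ) (affineCoord (index (j x))) (j y) :=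
    mdifferentiableAt_atlas (e := affineChart (index (j x)))
      (show affineChart _ ∈ atlas (Fin N → ℂ) (CPSpace N) from Set.mem_range_self _) hy
  obtain ⟨T, hT⟩ : ∃ T : (Fin N → ℂ) →L[ℂ] (Fin N → ℂ), HasMFDerivAt 𝓘(ℂ, Fin N → ℂ)
    𝓘(ℂ, Fin N → ℂ) (affineCoord (index (j x))) (j y) T := ⟨_, hκ.hasMFDerivAt⟩
  have key := fun w => diffV_comp_CPSpace (n := n) hT (hj.mdifferentiableAt hh y) w
  change diffV n (fun y => affineCoord (index (j x)) (j y)) y (S.J y v) =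
    Complex.I • diffV n (fun y => affineCoord (index (j x)) (j y)) y v
  rw [key, key, hj.map_J, _root_.map_smul]

/-- A real differentiable function of the affine coordinates with complex linear differential is a
CR function. -/
theorem diffV_comp_affineLift_J {F : Type*} [NormedAddCommGroup F] [NormedSpace ℂ F]
    [NormedSpace ℝ F] [IsScalarTower ℝ ℂ F] (hh : 1 ≤ h) (hj : S.IsCREmbedding h j) {x y : M}
    (hy : y ∈ affineDomain j x) {H : (Fin N → ℂ) → F}
    (hH : DifferentiableAt ℂ H (affineLift j x y)) (v : S.D y) :
    diffV n (fun y => H (affineLift j x y)) y (S.J y v) =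
      Complex.I • diffV n (fun y => H (affineLift j x y)) y v := by
  have hu : MDifferentiableAt (RModel n) 𝓘(ℝ, Fin N → ℂ) (affineLift j x) y :=
    ((contMDiffOn_affineLift hj.contMDiff x).contMDiffAt
      ((isOpen_affineDomain hj.isEmbedding.continuous x).mem_nhds hy)).mdifferentiableAt
      (by exact_mod_cast (zero_lt_one.trans_le hh).ne')
  rw [diffV_comp (hH.restrictScalars ℝ) hu, diffV_comp (hH.restrictScalars ℝ) hu,
    hj.diffV_affineLift_J hh hy, hH.fderiv_restrictScalars ℝ]
  exact _root_.map_smul (fderiv ℂ H (affineLift j x y)) _ _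

end AlmostCRStructure.IsCREmbedding

/-- Holomorphic functions of the affine coordinates that are independent on `D x` form,
together with a local equation of the foliation, CR coordinates at `x`. -/
theorem AlmostCRStructure.exists_crChart {r : ℕ∞} (hh : 1 ≤ h) (hr : 1 ≤ r) (hrh : r ≤ h)
    [IsManifold (RModel n) h M] (hflat : S.IsLeviFlat r) (hj : S.IsCREmbedding h j) (x : M)
    {H : (Fin N → ℂ) → (Fin n → ℂ)} (hH : ContDiff ℂ ω H) (hH0 : H (affineLift j x x) = 0)
    (hinj : ∀ v : S.D x, fderiv ℂ H (affineLift j x x) (diffCP n j x v) = 0 → v = 0)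
    {O : Set M} (hO : IsOpen O) (hxO : x ∈ O) :
    ∃ e : OpenPartialHomeomorph M ((Fin n → ℂ) × ℝ), S.IsCRChartAt r x e ∧
      e.source ⊆ O ∩ affineDomain j x ∧ ∀ y ∈ e.source, (e y).1 = H (affineLift j x y) := by
  have : IsManifold (RModel n) r M := IsManifold.of_le (n := (h : ℕ∞ω)) (by exact_mod_cast hrh)
  have hr0 : (r : ℕ∞ω) ≠ 0 := by exact_mod_cast (zero_lt_one.trans_le hr).ne'
  obtain ⟨U, hU, hxU, s, hs, hsker⟩ := hflat x
  have hdom := isOpen_affineDomain hj.isEmbedding.continuous x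
  have hW : IsOpen (O ∩ affineDomain j x ∩ U) := (hO.inter hdom).inter hU
  have hxW : x ∈ O ∩ affineDomain j x ∩ U := ⟨⟨hxO, mem_affineDomain_self j x⟩, hxU⟩
  have hz : ContMDiffOn (RModel n) 𝓘(ℝ, Fin n → ℂ) r (fun y => H (affineLift j x y))
      (O ∩ affineDomain j x ∩ U) := by
    have h1 : ContMDiff 𝓘(ℝ, Fin N → ℂ) 𝓘(ℝ, Fin n → ℂ) r H :=
      ((hH.restrict_scalars ℝ).of_le le_top).contMDiff
    exact h1.comp_contMDiffOn (((contMDiffOn_affineLift hj.contMDiff x).of_le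
      (by exact_mod_cast hrh)).mono fun y hy => hy.1.2)
  have hs' : ContMDiffOn (RModel n) 𝓘(ℝ, ℝ) r (fun y => s y - s x) (O ∩ affineDomain j x ∩ U) := by
    have h1 : ContMDiff 𝓘(ℝ, ℝ) 𝓘(ℝ, ℝ) r fun t : ℝ => t - s x :=
      (contDiff_id.sub contDiff_const).contMDiff
    exact h1.comp_contMDiffOn (hs.mono Set.inter_subset_right)
  let E : M → (Fin n → ℂ) × ℝ := fun y => (H (affineLift j x y), s y - s x)
  have hE : ContMDiffOn (RModel n) 𝓘(ℝ, (Fin n → ℂ) × ℝ) r E (O ∩ affineDomain j x ∩ U) :=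
    hz.prodMk_space hs'
  have hEd : ∀ y ∈ O ∩ affineDomain j x ∩ U,
      MDifferentiableAt (RModel n) 𝓘(ℝ, (Fin n → ℂ) × ℝ) E y := fun y hy =>
    (hE.contMDiffAt (hW.mem_nhds hy)).mdifferentiableAt hr0
  have hE1 : ∀ y ∈ O ∩ affineDomain j x ∩ U, ∀ v,
      (diffV n E y v).1 = diffV n (fun y => H (affineLift j x y)) y v := fun y hy v => by
    have := diffV_comp (g := Prod.fst) differentiableAt_fst (hEd y hy) v
    rw [fderiv_fst] at this
    exact this.symm
  have hE2 : ∀ y ∈ O ∩ affineDomain j x ∩ U, ∀ v, (diffV n E y v).2 = diffV n s y v :=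
      fun y hy v => by
    have h1 := diffV_comp (g := Prod.snd) differentiableAt_snd (hEd y hy) v
    have hsd : MDifferentiableAt (RModel n) 𝓘(ℝ, ℝ) s y :=
      (hs.contMDiffAt (hU.mem_nhds hy.2)).mdifferentiableAt hr0
    have h2 := diffV_comp (g := fun t : ℝ => t - s x) (by fun_prop) hsd v
    rw [fderiv_snd] at h1
    rw [fderiv_sub_const, fderiv_fun_id] at h2
    exact h1.symm.trans h2
  have hsD : ∀ y ∈ U, ∀ v, diffV n s y v = 0 ↔ v ∈ S.D y := fun y hy v => by
    rw [← hsker y hy]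
    rfl
  have hEinj : Function.Injective (diffV n E x) := by
    rw [injective_iff_map_eq_zero]
    intro v hv
    have h2 := hE2 x hxW v
    rw [hv] at h2
    have hvD : v ∈ S.D x := (hsD x hxU v).1 h2.symm
    have h1 := hE1 x hxW v
    have hu : MDifferentiableAt (RModel n) 𝓘(ℝ, Fin N → ℂ) (affineLift j x) x :=
      ((contMDiffOn_affineLift hj.contMDiff x).contMDiffAt
        (hdom.mem_nhds hxW.1.2)).mdifferentiableAt
        (by exact_mod_cast (zero_lt_one.trans_le hh).ne')
    have hHd : DifferentiableAt ℂ H (affineLift j x x) := hH.differentiable (by simp) _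
    rw [hv, diffV_comp (hHd.restrictScalars ℝ) hu, hHd.fderiv_restrictScalars ℝ,
      diffV_affineLift_self (hj.mdifferentiableAt hh x)] at h1
    exact congrArg Subtype.val (hinj ⟨v, hvD⟩ h1.symm)
  have hfin : Module.finrank ℝ (TangentSpace (RModel n) x) =
      Module.finrank ℝ ((Fin n → ℂ) × ℝ) := by
    have : Module.finrank ℝ (TangentSpace (RModel n) x) = 2 * n + 1 :=
      finrank_euclideanSpace_fin (𝕜 := ℝ) (n := 2 * n + 1)
    rw [this, Module.finrank_prod, Module.finrank_pi_fintype]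
    simp [mul_comm]
  have : FiniteDimensional ℝ (TangentSpace (RModel n) x) :=
    inferInstanceAs (FiniteDimensional ℝ (EuclideanSpace ℝ (Fin (2 * n + 1))))
  have hbij : Function.Bijective (diffV n E x) :=
    ⟨hEinj, (LinearMap.injective_iff_surjective_of_finrank_eq_finrank
      (f := (diffV n E x).toLinearMap) hfin).1 hEinj⟩
  obtain ⟨e, hxe, heW, heE, he, hesymm⟩ :=
    exists_openPartialHomeomorph_of_bijective_diffV hr hW hE hxW hbij
  have hde : ∀ y ∈ e.source, diffCR (n := n) e y = diffV n E y := fun y hy =>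
    diffV_congr (heE.eventuallyEq_of_mem (e.open_source.mem_nhds hy))
  refine ⟨e, ⟨hxe, ?_, he, hesymm, fun y hy v => ?_, fun y hy v => ?_⟩, fun y hy => (heW hy).1,
    fun y hy => by rw [heE hy]⟩
  · rw [heE hxe]
    simp [E, hH0]
  · rw [hde y hy, hE2 y (heW hy)]
    exact (hsD y (heW hy).2 _).2 v.2
  · rw [hde y hy, hE1 y (heW hy), hE1 y (heW hy)]
    exact hj.diffV_comp_affineLift_J hh (heW hy).1.2 (hH.differentiable (by simp) _) v

end CRMaps

/-! ### Linear algebra of complex subspaces -/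

section LinearAlgebra

/-- The image of an injective real linear map that intertwines a complex structure with
multiplication by `I` is a complex subspace. -/
theorem exists_complex_submodule_eq_range {B A : Type*} [AddCommGroup B] [Module ℝ B]
    [AddCommGroup A] [Module ℂ A] [Module ℝ A] [IsScalarTower ℝ ℂ A] {n : ℕ}
    (hB : Module.finrank ℝ B = 2 * n) (φ : B →ₗ[ℝ] A) (J : B → B)
    (hJ : ∀ v, φ (J v) = Complex.I • φ v) (hφ : Function.Injective φ) :
    ∃ E : Submodule ℂ A, Module.finrank ℂ E = n ∧ ∀ w, w ∈ E ↔ ∃ v, φ v = w := by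
  let E : Submodule ℂ A :=
    { carrier := Set.range φ
      add_mem' := by
        rintro _ _ ⟨v, rfl⟩ ⟨w, rfl⟩
        exact ⟨v + w, map_add φ v w⟩
      zero_mem' := ⟨0, map_zero φ⟩
      smul_mem' := by
        rintro c _ ⟨v, rfl⟩
        refine ⟨c.re • v + c.im • J v, ?_⟩
        conv_rhs => rw [← Complex.re_add_im c, add_smul, mul_smul, complex_ofReal_smul,
          complex_ofReal_smul]
        rw [map_add, map_smul, map_smul, hJ] }
  have hE : E.restrictScalars ℝ = LinearMap.range φ := rfl
  refine ⟨E, ?_, fun w => Iff.rfl⟩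
  have h1 : Module.finrank ℝ (E.restrictScalars ℝ) = 2 * n := by
    rw [hE, LinearMap.finrank_range_of_inj hφ, hB]
  have h2 : Module.finrank ℝ E = 2 * Module.finrank ℂ E := by
    rw [← Complex.finrank_real_complex, Module.finrank_mul_finrank]
  have h3 : Module.finrank ℝ E = 2 * n := h1
  omega

theorem exists_clm_injOn {N n : ℕ} (E : Submodule ℂ (Fin N → ℂ)) (hE : Module.finrank ℂ E = n) :
    ∃ Λ : (Fin N → ℂ) →L[ℂ] (Fin n → ℂ), ∀ w ∈ E, Λ w = 0 → w = 0 := by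
  obtain ⟨ρ, hρ⟩ := E.subtype.exists_leftInverse_of_injective (Submodule.ker_subtype E)
  let b := Module.finBasisOfFinrankEq ℂ E hE
  refine ⟨LinearMap.toContinuousLinearMap (b.equivFun.toLinearMap.comp ρ), fun w hw h => ?_⟩
  have h1 : ρ w = ⟨w, hw⟩ := DFunLike.congr_fun hρ ⟨w, hw⟩
  have h2 : b.equivFun (ρ w) = 0 := h
  rw [LinearEquiv.map_eq_zero_iff, h1] at h2
  exact congrArg Subtype.val h2

/-- A surjective linear map is completed to linear coordinates by coordinates of its kernel. -/
theorem exists_linearMap_injective_of_surjective {E : Type*} [AddCommGroup E] [Module ℂ E]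
    [FiniteDimensional ℂ E] {l : ℕ} (L : E →ₗ[ℂ] (Fin l → ℂ)) (hL : Function.Surjective L) :
    ∃ (m : ℕ) (Q : E →ₗ[ℂ] (Fin m → ℂ)), Module.finrank ℂ E = m + l ∧
      ∀ w, L w = 0 → Q w = 0 → w = 0 := by
  have hdim := L.finrank_range_add_finrank_ker
  rw [LinearMap.range_eq_top.2 hL, finrank_top, Module.finrank_fin_fun, add_comm] at hdim
  obtain ⟨C, hC⟩ := L.ker.exists_isCompl
  let b := Module.finBasis ℂ L.ker
  refine ⟨_, b.equivFun.toLinearMap.comp (L.ker.projectionOnto C hC), hdim.symm, fun w hw h => ?_⟩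
  have h2 : b.equivFun (L.ker.projectionOnto C hC w) = 0 := h
  have h3 : L.ker.projectionOnto C hC w = ⟨w, hw⟩ :=
    DFunLike.congr_fun (L.ker.projectionOnto_comp_subtype hC) ⟨w, hw⟩
  rw [LinearEquiv.map_eq_zero_iff, h3] at h2
  exact congrArg Subtype.val h2

/-- Two independent linear forms on `E` extend to a full set of linear coordinates of `E`. -/
theorem exists_clm_injOn_extending {N n : ℕ} (E : Submodule ℂ (Fin N → ℂ))
    (hE : Module.finrank ℂ E = n) (L : (Fin N → ℂ) →ₗ[ℂ] (Fin 2 → ℂ)) (hL : E.map L = ⊤) :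
    ∃ (h0 : 0 < n) (h1 : 1 < n) (Λ : (Fin N → ℂ) →L[ℂ] (Fin n → ℂ)),
      (∀ w ∈ E, Λ w = 0 → w = 0) ∧ ∀ w, Λ w ⟨0, h0⟩ = L w 0 ∧ Λ w ⟨1, h1⟩ = L w 1 := by
  have hrange : Function.Surjective (L.comp E.subtype) := by
    rw [← LinearMap.range_eq_top, LinearMap.range_comp, Submodule.range_subtype, hL]
  obtain ⟨m, Q', hm, hQ'⟩ := exists_linearMap_injective_of_surjective _ hrange
  obtain rfl : n = m + 2 := hE.symm.trans hm
  obtain ⟨ρ, hρ⟩ := E.subtype.exists_leftInverse_of_injective (Submodule.ker_subtype E)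
  let Q : (Fin N → ℂ) →ₗ[ℂ] (Fin m → ℂ) := Q'.comp ρ
  let Λ : (Fin N → ℂ) →ₗ[ℂ] (Fin (m + 2) → ℂ) :=
    { toFun := fun w => Fin.cons (L w 0) (Fin.cons (L w 1) (Q w))
      map_add' := fun v w => by
        funext l
        refine Fin.cases ?_ (fun l => Fin.cases ?_ (fun l => ?_) l) l <;> simp
      map_smul' := fun c w => by
        funext l
        refine Fin.cases ?_ (fun l => Fin.cases ?_ (fun l => ?_) l) l <;> simp }
  refine ⟨by omega, by omega, LinearMap.toContinuousLinearMap Λ, fun w hw h => ?_,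
    fun w => ⟨rfl, rfl⟩⟩
  have h0 : L w 0 = 0 := congrFun h 0
  have h1 : L w 1 = 0 := congrFun h 1
  have hQ : Q' (ρ w) = 0 := funext fun l => congrFun h l.succ.succ
  have e1 : ρ w = ⟨w, hw⟩ := DFunLike.congr_fun hρ ⟨w, hw⟩
  rw [e1] at hQ
  refine congrArg Subtype.val (hQ' ⟨w, hw⟩ ?_ hQ)
  funext l
  fin_cases l
  · exact h0
  · exact h1

/-- A complex linear map that maps a real subspace `T` onto its target maps already the complex
part `E` of `T` onto it, when `E` has real codimension one in `T`: the image of `E` has real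
codimension at most one, and an even one. -/
theorem map_eq_top_of_surjective_of_finrank_le {T A B : Type*} [AddCommGroup T] [Module ℝ T]
    [FiniteDimensional ℝ T] [AddCommGroup A] [Module ℂ A] [AddCommGroup B] [Module ℂ B]
    [Module ℝ A] [IsScalarTower ℝ ℂ A] [Module ℝ B] [IsScalarTower ℝ ℂ B] [FiniteDimensional ℂ B]
    (φ : T →ₗ[ℝ] A) (D : Submodule ℝ T) (hD : Module.finrank ℝ T ≤ Module.finrank ℝ D + 1)
    (E : Submodule ℂ A) (hDE : ∀ v ∈ D, φ v ∈ E) (L : A →ₗ[ℂ] B)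
    (hL : Function.Surjective fun v => L (φ v)) : E.map L = ⊤ := by
  let q : B →ₗ[ℂ] B ⧸ E.map L := (E.map L).mkQ
  let g : T →ₗ[ℝ] B ⧸ E.map L := ((q.comp L).restrictScalars ℝ).comp φ
  have hg : g.range = ⊤ := LinearMap.range_eq_top.2
    ((Submodule.mkQ_surjective (E.map L)).comp hL)
  have hker : D ≤ g.ker := fun v hv => by
    rw [LinearMap.mem_ker]
    exact (Submodule.Quotient.mk_eq_zero _).2 ⟨φ v, hDE v hv, rfl⟩
  have h1 := g.finrank_range_add_finrank_ker
  have h2 := Submodule.finrank_mono hker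
  rw [hg, finrank_top] at h1
  have h3 : Module.finrank ℝ (B ⧸ E.map L) = 2 * Module.finrank ℂ (B ⧸ E.map L) := by
    rw [← Complex.finrank_real_complex, Module.finrank_mul_finrank]
  have h4 : Module.finrank ℂ (B ⧸ E.map L) = 0 := by omega
  have h5 : Subsingleton (B ⧸ E.map L) := Module.finrank_zero_iff.1 h4
  exact (Submodule.eq_top_iff').2 fun v =>
    (Submodule.Quotient.mk_eq_zero _).1 (Subsingleton.elim _ _)

end LinearAlgebra

/-! ### Base points -/

section Base

open CPSpace

variable {n N : ℕ} {M : Type*} [TopologicalSpace M]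
  [ChartedSpace (EuclideanSpace ℝ (Fin (2 * n + 1))) M]
  {S : AlmostCRStructure n M} {h r : ℕ∞} {j : M → CPSpace N}

/-- The image of `D x` in the tangent space of projective space is a complex subspace. -/
theorem AlmostCRStructure.IsCREmbedding.exists_image_D (hj : S.IsCREmbedding h j) (x : M) :
    ∃ E : Submodule ℂ (Fin N → ℂ), Module.finrank ℂ E = n ∧
      ∀ w, w ∈ E ↔ ∃ v : S.D x, diffCP n j x v = w :=
  exists_complex_submodule_eq_range (S.finrank_D x)
    ((diffCP n j x).toLinearMap.comp (S.D x).subtype) (S.J x) (hj.map_J x)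
    ((hj.injective_diff x).comp Subtype.val_injective)

theorem finrank_tangentSpace (x : M) : Module.finrank ℝ (TangentSpace (RModel n) x) = 2 * n + 1 :=
  finrank_euclideanSpace_fin (𝕜 := ℝ) (n := 2 * n + 1)

instance (x : M) : FiniteDimensional ℝ (TangentSpace (RModel n) x) :=
  inferInstanceAs (FiniteDimensional ℝ (EuclideanSpace ℝ (Fin (2 * n + 1))))

/-- Normal form of a Lefschetz pencil at a base point. -/
theorem IsLefschetzPencil.exists_crChart_base (hh : 1 ≤ h) (hr : 1 ≤ r) (hrh : r ≤ h)
    [IsManifold (RModel n) h M] (hflat : S.IsLeviFlat r) (hj : S.IsCREmbedding h j) {k : ℕ}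
    {P₀ P₁ : MvPolynomial (Fin (N + 1)) ℂ} (hP : IsLefschetzPencil S j k P₀ P₁) {x : M}
    (hx : x ∈ AlmostCRStructure.base j P₀ P₁) :
    ∃ (h0 : 0 < n) (h1 : 1 < n) (e : OpenPartialHomeomorph M ((Fin n → ℂ) × ℝ))
      (ψ : OpenPartialHomeomorph (CPSpace 1) (Fin 1 → ℂ)),
      S.IsCRChartAt r x e ∧
      ψ ∈ IsManifold.maximalAtlas 𝓘(ℂ, Fin 1 → ℂ) ω (CPSpace 1) ∧
      (∀ y ∈ e.source, y ∈ AlmostCRStructure.base j P₀ P₁ ↔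
        (e y).1 ⟨0, h0⟩ = 0 ∧ (e y).1 ⟨1, h1⟩ = 0) ∧
      (∀ y ∈ e.source \ AlmostCRStructure.base j P₀ P₁,
        (AlmostCRStructure.pencil j P₀ P₁ y ∈ ψ.source ↔ (e y).1 ⟨0, h0⟩ ≠ 0) ∧
        ((e y).1 ⟨0, h0⟩ ≠ 0 →
          ψ (AlmostCRStructure.pencil j P₀ P₁ y) 0 =
            (e y).1 ⟨1, h1⟩ / (e y).1 ⟨0, h0⟩)) := by
  set i := index (j x) with hi
  set a := affineLift j x x with ha
  have hzero : ∀ {P : MvPolynomial (Fin (N + 1)) ℂ}, P.IsHomogeneous k → ∀ {y},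
      y ∈ affineDomain j x → (MvPolynomial.eval (j y).rep P = 0 ↔ dehom i P (affineLift j x y) = 0) :=
    fun hP y hy => eval_rep_eq_zero_iff hP hy
  have hd : ∀ P, HasFDerivAt (dehom i P) (diffAt P (j x)) a := fun P =>
    ((contDiff_dehom i P).differentiable (by simp) a).hasFDerivAt
  let L : (Fin N → ℂ) →ₗ[ℂ] (Fin 2 → ℂ) :=
    LinearMap.pi ![(diffAt P₀ (j x)).toLinearMap, (diffAt P₁ (j x)).toLinearMap]
  have hL0 : ∀ w, L w 0 = diffAt P₀ (j x) w := fun w => rfl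
  have hL1 : ∀ w, L w 1 = diffAt P₁ (j x) w := fun w => rfl
  -- The two differentials are linearly independent because `P₀` and `P₁` are members of the pencil.
  have hLsurj : Function.Surjective L := by
    have hind := hP.transversal_members 1 0 0 1 (by simp) (j x) (by
      simpa [baseLocus] using (show j x ∈ zeroSet P₀ ∩ zeroSet P₁ from hx))
    simp only [one_smul, zero_smul, add_zero, zero_add] at hind
    rw [← LinearMap.range_eq_top]
    by_contra hne
    obtain ⟨f, hf, hfr⟩ := Submodule.exists_le_ker_of_lt_top _ (lt_top_iff_ne_top.2 hne)
    refine hf ?_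
    have hcomb : ∀ v : Fin 2 → ℂ, f v = f (Pi.single 0 1) * v 0 + f (Pi.single 1 1) * v 1 := by
      intro v
      have : v = v 0 • Pi.single 0 1 + v 1 • Pi.single 1 1 := by
        funext l
        fin_cases l <;> simp
      conv_lhs => rw [this]
      simp [mul_comm]
    have h0 : f (Pi.single 0 1) • diffAt P₀ (j x) + f (Pi.single 1 1) • diffAt P₁ (j x) = 0 := by
      ext w
      have : f (L w) = 0 := hfr (LinearMap.mem_range_self L w)
      rw [hcomb, hL0, hL1] at this
      simpa using this
    obtain ⟨h1, h2⟩ := LinearIndependent.pair_iff.1 hind _ _ h0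
    refine LinearMap.ext fun v => ?_
    rw [hcomb v, h1, h2]
    simp
  have hsurj : Function.Surjective fun v => L (diffCP n j x v) := by
    intro b
    obtain ⟨w, rfl⟩ := hLsurj b
    have hw : w ∈ (⊤ : Submodule ℝ (Fin N → ℂ)) := trivial
    rw [← hP.transversal_base x hx] at hw
    obtain ⟨_, ⟨v, rfl⟩, w', hw', rfl⟩ := Submodule.mem_sup.1 hw
    refine ⟨v, ?_⟩
    have : L w' = 0 := by
      funext l
      fin_cases l
      · exact hw'.1
      · exact hw'.2
    simp [this]
  obtain ⟨E, hEn, hE⟩ := hj.exists_image_D x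
  have hEL : E.map L = ⊤ := by
    refine map_eq_top_of_surjective_of_finrank_le (diffCP n j x).toLinearMap (S.D x) ?_ E
      (fun v hv => (hE _).2 ⟨⟨v, hv⟩, rfl⟩) L hsurj
    rw [finrank_tangentSpace, S.finrank_D]
  obtain ⟨h0, h1, Λ, hΛ, hΛL⟩ := exists_clm_injOn_extending E hEn L hEL
  -- The linear coordinates, with the first two replaced by the dehomogenized polynomials.
  let H : (Fin N → ℂ) → (Fin n → ℂ) := fun w => Λ (w - a) +
    (dehom i P₀ w - diffAt P₀ (j x) (w - a)) • Pi.single ⟨0, h0⟩ (1 : ℂ) +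
    (dehom i P₁ w - diffAt P₁ (j x) (w - a)) • Pi.single ⟨1, h1⟩ (1 : ℂ)
  have hH : ContDiff ℂ ω H := by
    have hp₀ := contDiff_dehom i P₀
    have hp₁ := contDiff_dehom i P₁
    fun_prop
  have hH0 : ∀ w, H w ⟨0, h0⟩ = dehom i P₀ w := fun w => by
    simp [H, -map_sub, (hΛL _).1, hL0]
  have hH1 : ∀ w, H w ⟨1, h1⟩ = dehom i P₁ w := fun w => by
    simp [H, -map_sub, (hΛL _).2, hL1]
  have hxdom := mem_affineDomain_self j x
  have hHa : H a = 0 := by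
    have e0 : dehom i P₀ a = 0 := (hzero hP.isHomogeneous₀ hxdom).1 hx.1
    have e1 : dehom i P₁ a = 0 := (hzero hP.isHomogeneous₁ hxdom).1 hx.2
    simp [H, e0, e1]
  have hHd : fderiv ℂ H a = Λ := by
    have hsub : HasFDerivAt (fun w => w - a) (ContinuousLinearMap.id ℂ (Fin N → ℂ)) a :=
      (hasFDerivAt_id a).sub_const a
    have hcomp : ∀ {G : Type} [NormedAddCommGroup G] [NormedSpace ℂ G]
        (A : (Fin N → ℂ) →L[ℂ] G), HasFDerivAt (fun w => A (w - a)) A a := fun A => by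
      have := A.hasFDerivAt.comp a hsub
      rwa [ContinuousLinearMap.comp_id] at this
    have h := ((hcomp Λ).add (((hd P₀).sub (hcomp (diffAt P₀ (j x)))).smul_const
      (Pi.single ⟨0, h0⟩ (1 : ℂ) : Fin n → ℂ))).add (((hd P₁).sub (hcomp (diffAt P₁ (j x)))).smul_const
      (Pi.single ⟨1, h1⟩ (1 : ℂ) : Fin n → ℂ))
    refine h.fderiv.trans ?_
    ext w
    simp
  obtain ⟨e, he, hesource, heH⟩ := S.exists_crChart hh hr hrh hflat hj x hH hHa
    (fun v hv => by
      rw [← ha, hHd] at hv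
      have := hΛ _ ((hE _).2 ⟨v, rfl⟩) hv
      exact Subtype.ext (hj.injective_diff x (by simpa using this)))
    isOpen_univ (Set.mem_univ x)
  have hez0 : ∀ y ∈ e.source, (e y).1 ⟨0, h0⟩ = dehom i P₀ (affineLift j x y) := fun y hy => by
    rw [heH y hy, hH0]
  have hez1 : ∀ y ∈ e.source, (e y).1 ⟨1, h1⟩ = dehom i P₁ (affineLift j x y) := fun y hy => by
    rw [heH y hy, hH1]
  refine ⟨h0, h1, e, affineChart 0, he, IsManifold.subset_maximalAtlas (Set.mem_range_self _),
    fun y hy => ?_, fun y hy => ⟨?_, fun _ => ?_⟩⟩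
  · rw [hez0 y hy, hez1 y hy, ← hzero hP.isHomogeneous₀ (hesource hy).2,
      ← hzero hP.isHomogeneous₁ (hesource hy).2]
    rfl
  · rw [hez0 y hy.1, Ne, ← hzero hP.isHomogeneous₀ (hesource hy.1).2]
    exact pencilMap_rep_ne_zero_iff hy.2 0
  · rw [hez0 y hy.1, hez1 y hy.1]
    exact affineCoord_pencilMap hP.isHomogeneous₀ hP.isHomogeneous₁ hy.2 (hesource hy.1).2 0

end Base

/-! ### CR functions in CR coordinates -/

section CRCharts

variable {n : ℕ} {M : Type*} [TopologicalSpace M]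
  [ChartedSpace (EuclideanSpace ℝ (Fin (2 * n + 1))) M]
  {S : AlmostCRStructure n M} {r : ℕ∞} {x : M} {e : OpenPartialHomeomorph M ((Fin n → ℂ) × ℝ)}

namespace AlmostCRStructure.IsCRChartAt

theorem mdifferentiable (hr : 1 ≤ r) (he : S.IsCRChartAt r x e) :
    e.MDifferentiable (RModel n) 𝓘(ℝ, (Fin n → ℂ) × ℝ) := by
  have hr0 : (r : ℕ∞ω) ≠ 0 := by exact_mod_cast (zero_lt_one.trans_le hr).ne'
  exact ⟨he.contMDiffOn.mdifferentiableOn hr0, he.contMDiffOn_symm.mdifferentiableOn hr0⟩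

theorem mdifferentiableAt (hr : 1 ≤ r) (he : S.IsCRChartAt r x e) {y : M} (hy : y ∈ e.source) :
    MDifferentiableAt (RModel n) 𝓘(ℝ, (Fin n → ℂ) × ℝ) e y :=
  (he.mdifferentiable hr).mdifferentiableAt hy

theorem diffCR_injective (hr : 1 ≤ r) (he : S.IsCRChartAt r x e) {y : M} (hy : y ∈ e.source) :
    Function.Injective (diffCR (n := n) e y) :=
  (he.mdifferentiable hr).mfderiv_injective hy

theorem diffCR_eq_inl (he : S.IsCRChartAt r x e) {y : M} (hy : y ∈ e.source) (v : S.D y) :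
    diffCR e y v = ContinuousLinearMap.inl ℝ (Fin n → ℂ) ℝ (diffCR e y v).1 :=
  Prod.ext rfl (he.map_D y hy v)

/-- By dimension, the differential of CR coordinates maps `D` onto `ℂ^n × 0`. -/
theorem exists_diffCR_fst_eq (hr : 1 ≤ r) (he : S.IsCRChartAt r x e) {y : M} (hy : y ∈ e.source)
    (z : Fin n → ℂ) : ∃ v : S.D y, (diffCR e y v).1 = z := by
  let A : S.D y →ₗ[ℝ] (Fin n → ℂ) :=
    (LinearMap.fst ℝ (Fin n → ℂ) ℝ).comp ((diffCR (n := n) e y).toLinearMap.comp (S.D y).subtype)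
  have hA : Function.Injective A := by
    rw [injective_iff_map_eq_zero]
    intro v hv
    have h1 : (diffCR e y v).1 = 0 := hv
    refine Subtype.ext (he.diffCR_injective hr hy ?_)
    rw [he.diffCR_eq_inl hy v, h1]
    simp
  have hfin : Module.finrank ℝ (S.D y) = Module.finrank ℝ (Fin n → ℂ) := by
    rw [S.finrank_D, Module.finrank_pi_fintype]
    simp [mul_comm]
  exact (LinearMap.injective_iff_surjective_of_finrank_eq_finrank hfin).1 hA z

theorem fderiv_comp_symm {F : Type*} [NormedAddCommGroup F] [NormedSpace ℝ F] {c : M → F}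
    (hr : 1 ≤ r) (he : S.IsCRChartAt r x e) {y : M} (hy : y ∈ e.source)
    (hc : DifferentiableAt ℝ (c ∘ e.symm) (e y)) (v : TangentSpace (RModel n) y) :
    fderiv ℝ (c ∘ e.symm) (e y) (diffCR e y v) = diffV n c y v := by
  have h1 := diffV_comp (g := c ∘ e.symm) hc (he.mdifferentiableAt hr hy) v
  have h2 : (fun y => (c ∘ e.symm) (e y)) =ᶠ[𝓝 y] c :=
    Set.EqOn.eventuallyEq_of_mem (s := e.source) (fun y' hy' => congrArg c (e.left_inv hy'))
      (e.open_source.mem_nhds hy)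
  rw [diffV_congr h2] at h1
  exact h1.symm

variable {F : Type} [NormedAddCommGroup F] [NormedSpace ℂ F] [NormedSpace ℝ F] {c : M → F}

/-- A function on `M` with differential complex linear on `D` is a CR function of the coordinates. -/
theorem crContDiffOn_comp_symm (hr : 1 ≤ r) (he : S.IsCRChartAt r x e)
    (hc : ContMDiffOn (RModel n) 𝓘(ℝ, F) r c e.source)
    (hJ : ∀ y ∈ e.source, ∀ v : S.D y, diffV n c y (S.J y v) = Complex.I • diffV n c y v) :
    CRContDiffOn (ContinuousLinearMap.inl ℝ (Fin n → ℂ) ℝ) r (c ∘ e.symm) e.target := by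
  have hcd : ContDiffOn ℝ r (c ∘ e.symm) e.target :=
    contMDiffOn_iff_contDiffOn.1 (hc.comp he.contMDiffOn_symm fun q hq => e.map_target hq)
  have hr0 : (r : ℕ∞ω) ≠ 0 := by exact_mod_cast (zero_lt_one.trans_le hr).ne'
  refine ⟨hcd, fun p hp z => ?_⟩
  have hd : DifferentiableAt ℝ (c ∘ e.symm) p :=
    (hcd.contDiffAt (e.open_target.mem_nhds hp)).differentiableAt hr0
  have hy := e.map_target hp
  obtain ⟨v, rfl⟩ := he.exists_diffCR_fst_eq hr hy z
  rw [← e.right_inv hp] at hd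
  have h1 := fun w => he.fderiv_comp_symm hr hy hd w
  rw [← he.map_J _ hy v, ← he.diffCR_eq_inl hy v, ← he.diffCR_eq_inl hy (S.J _ v)]
  rw [e.right_inv hp] at h1
  rw [h1, h1, hJ _ hy]

theorem leafDeriv_comp_symm [IsScalarTower ℝ ℂ F] (hr : 1 ≤ r) (he : S.IsCRChartAt r x e)
    (hf : CRContDiffOn (ContinuousLinearMap.inl ℝ (Fin n → ℂ) ℝ) r (c ∘ e.symm) e.target)
    {y : M} (hy : y ∈ e.source) (v : S.D y) :
    leafDeriv (ContinuousLinearMap.inl ℝ (Fin n → ℂ) ℝ) (c ∘ e.symm) (e y) (diffCR e y v).1 =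
      diffV n c y v := by
  have hp := e.map_source hy
  rw [hf.leafDeriv_apply hr e.open_target hp, ← he.diffCR_eq_inl hy v,
    he.fderiv_comp_symm hr hy (hf.differentiableAt hr e.open_target hp)]

/-- Composing CR coordinates with a CR diffeomorphism that keeps the real coordinate. -/
theorem trans_foliated (hr : 1 ≤ r) (he : S.IsCRChartAt r x e)
    {Ψ : OpenPartialHomeomorph ((Fin n → ℂ) × ℝ) ((Fin n → ℂ) × ℝ)}
    {ζ : (Fin n → ℂ) × ℝ → (Fin n → ℂ)} (h0 : 0 ∈ Ψ.source) (hΨ0 : Ψ 0 = 0)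
    (hΨ : ⇑Ψ = fun p => (ζ p, p.2))
    (hζ : CRContDiffOn (ContinuousLinearMap.inl ℝ (Fin n → ℂ) ℝ) r ζ Ψ.source)
    (hsymm : ContDiffOn ℝ r Ψ.symm Ψ.target) : S.IsCRChartAt r x (e.trans Ψ) := by
  have hΨd : ContDiffOn ℝ r Ψ Ψ.source := by
    rw [hΨ]
    exact hζ.contDiffOn.prodMk contDiffOn_snd
  have hsrc : ∀ y ∈ (e.trans Ψ).source, y ∈ e.source ∧ e y ∈ Ψ.source := fun y hy => by
    rwa [OpenPartialHomeomorph.trans_source] at hy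
  have hd : ∀ y ∈ (e.trans Ψ).source, ∀ v : S.D y, diffCR (e.trans Ψ) y v =
      (fderiv ℝ ζ (e y) (ContinuousLinearMap.inl ℝ (Fin n → ℂ) ℝ (diffCR e y v).1), 0) := by
    intro y hy v
    have hζd := hζ.differentiableAt hr Ψ.open_source (hsrc y hy).2
    have h1 : HasFDerivAt Ψ ((fderiv ℝ ζ (e y)).prod (ContinuousLinearMap.snd ℝ _ _)) (e y) := by
      rw [hΨ]
      exact hζd.hasFDerivAt.prodMk hasFDerivAt_snd
    have h2 := diffV_comp h1.differentiableAt (he.mdifferentiableAt hr (hsrc y hy).1) v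
    rw [h1.fderiv] at h2
    refine h2.trans ?_
    refine Prod.ext ?_ (he.map_D y (hsrc y hy).1 v)
    exact congrArg (fderiv ℝ ζ (e y)) (he.diffCR_eq_inl (hsrc y hy).1 v)
  refine ⟨?_, ?_, ?_, ?_, fun y hy v => by rw [hd y hy], fun y hy v => ?_⟩
  · rw [OpenPartialHomeomorph.trans_source]
    exact ⟨he.mem_source, by rwa [Set.mem_preimage, he.map_center]⟩
  · rw [OpenPartialHomeomorph.coe_trans, Function.comp_apply, he.map_center, hΨ0]
  · rw [OpenPartialHomeomorph.coe_trans]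
    exact (contMDiffOn_iff_contDiffOn.2 hΨd).comp
      (he.contMDiffOn.mono fun y hy => (hsrc y hy).1) fun y hy => (hsrc y hy).2
  · rw [OpenPartialHomeomorph.coe_trans_symm]
    refine he.contMDiffOn_symm.comp (contMDiffOn_iff_contDiffOn.2 (hsymm.mono ?_)) ?_
    · intro q hq
      rw [OpenPartialHomeomorph.trans_target] at hq
      exact hq.1
    · intro q hq
      rw [OpenPartialHomeomorph.trans_target] at hq
      exact hq.2
  · rw [hd y hy, hd y hy, he.map_J y (hsrc y hy).1]
    exact hζ.map_I_smul _ (hsrc y hy).2 _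

end AlmostCRStructure.IsCRChartAt

end CRCharts

/-! ### Transversality of jets and nondegeneracy -/

section Jets

theorem TransversalAlong.exists_mem {T A B : Type*} [AddCommGroup T] [Module ℝ T] [AddCommGroup A]
    [Module ℝ A] [AddCommGroup B] [Module ℝ B] {P : Submodule ℝ T} {da : T →ₗ[ℝ] A}
    {dF : T →ₗ[ℝ] B} (h : TransversalAlong P da dF) (b : B) : ∃ v ∈ P, dF v = b := by
  have hb : ((0, 0, b) : T × A × B) ∈ P.prod (⊤ : Submodule ℝ (A × B)) := ⟨P.zero_mem, trivial⟩
  rw [← (h : _ = P.prod (⊤ : Submodule ℝ (A × B)))] at hb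
  obtain ⟨g, ⟨⟨v, rfl⟩, hv⟩, s, ⟨⟨-, -, hs⟩, -⟩, hgs⟩ := Submodule.mem_sup.1 hb
  refine ⟨v, hv.1, ?_⟩
  have h2 : dF v + s.2.2 = b := congrArg (fun q : T × A × B => q.2.2) hgs
  rwa [(Submodule.mem_bot ℝ).1 hs, add_zero] at h2

/-- Where a differentiable family of linear maps vanishes, its pairing with a merely continuous
vector field is differentiable. -/
theorem hasFDerivAt_clm_apply_of_eq_zero {Y V F : Type*} [NormedAddCommGroup Y] [NormedSpace ℝ Y]
    [NormedAddCommGroup V] [NormedSpace ℝ V] [NormedAddCommGroup F] [NormedSpace ℝ F]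
    {g : Y → V →L[ℝ] F} {ζ : Y → V} {p : Y} {g' : Y →L[ℝ] V →L[ℝ] F} (hg : HasFDerivAt g g' p)
    (hg0 : g p = 0) (hζ : ContinuousAt ζ p) :
    HasFDerivAt (fun q => g q (ζ q)) (g'.flip (ζ p)) p := by
  have h1 : HasFDerivAt (fun q => g q (ζ p)) (g'.flip (ζ p)) p := by
    have := hg.clm_apply (hasFDerivAt_const (ζ p) p)
    refine this.congr_fderiv ?_
    ext w
    simp
  have h2 : HasFDerivAt (fun q => g q (ζ q - ζ p)) (0 : Y →L[ℝ] F) p := by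
    rw [hasFDerivAt_iff_isLittleO]
    have hO : g =O[𝓝 p] fun q => q - p := by
      have := hg.isBigO_sub
      simpa [hg0] using this
    have ho : (fun q => ζ q - ζ p) =o[𝓝 p] fun _ => (1 : ℝ) := by
      rw [Asymptotics.isLittleO_one_iff]
      simpa using hζ.tendsto.sub_const (ζ p)
    have h3 : (fun q => ‖g q‖ * ‖ζ q - ζ p‖) =o[𝓝 p] fun q => q - p := by
      have := hO.norm_left.norm_right.mul_isLittleO ho.norm_left
      simpa using this
    refine (Asymptotics.IsBigO.of_bound 1 (Filter.Eventually.of_forall fun q => ?_)).trans_isLittleO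
      h3
    simpa [hg0] using (g q).le_opNorm (ζ q - ζ p)
  refine ((h1.add h2).congr_fderiv (add_zero _)).congr_of_eventuallyEq
    (Filter.Eventually.of_forall fun q => ?_)
  simp

variable {n : ℕ} {M : Type*} [TopologicalSpace M]
  [ChartedSpace (EuclideanSpace ℝ (Fin (2 * n + 1))) M]
  {S : AlmostCRStructure n M} {r : ℕ∞} {x : M} {e : OpenPartialHomeomorph M ((Fin n → ℂ) × ℝ)}

/-- The components of a frame in CR coordinates are continuous, but in general no better, since CR
coordinates may be of class `C^1` only. -/
theorem AlmostCRStructure.IsCRChartAt.continuousAt_frame (hr : 1 ≤ r)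
    [IsManifold (RModel n) r M] (he : S.IsCRChartAt r x e)
    {V : ∀ y : M, S.D y}
    (hV : ContinuousAt (fun y => (diffV n (extChartAt (RModel n) x) y (V y) :
      EuclideanSpace ℝ (Fin (2 * n + 1)))) x) :
    ContinuousAt (fun y => (diffCR e y (V y)).1) x := by
  have hr0 : (r : ℕ∞ω) ≠ 0 := by exact_mod_cast (zero_lt_one.trans_le hr).ne'
  let χ := chartAt (EuclideanSpace ℝ (Fin (2 * n + 1))) x
  have hO : IsOpen (χ.target ∩ χ.symm ⁻¹' e.source) := χ.symm.isOpen_inter_preimage e.open_source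
  have hcd : ContDiffOn ℝ r (e ∘ χ.symm) (χ.target ∩ χ.symm ⁻¹' e.source) := by
    rw [← contMDiffOn_iff_contDiffOn]
    have hχ : ContMDiffOn (RModel n) (RModel n) r χ.symm χ.target := contMDiffOn_chart_symm
    exact he.contMDiffOn.comp (hχ.mono Set.inter_subset_left) fun q hq => hq.2
  have hxs : x ∈ χ.source := mem_chart_source _ x
  have hmem : ∀ y ∈ χ.source ∩ e.source, χ y ∈ χ.target ∩ χ.symm ⁻¹' e.source := fun y hy =>
    ⟨χ.map_source hy.1, by rw [Set.mem_preimage, χ.left_inv hy.1]; exact hy.2⟩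
  have hN : χ.source ∩ e.source ∈ 𝓝 x :=
    (χ.open_source.inter e.open_source).mem_nhds ⟨hxs, he.mem_source⟩
  have hfd : ContinuousAt (fun y => fderiv ℝ (e ∘ χ.symm) (χ y)) x := by
    have h1 : ContinuousAt (fderiv ℝ (e ∘ χ.symm)) (χ x) :=
      (hcd.continuousOn_fderiv_of_isOpen hO (by exact_mod_cast hr)).continuousAt
        (hO.mem_nhds (hmem x ⟨hxs, he.mem_source⟩))
    exact ContinuousAt.comp (f := χ) h1 (χ.continuousAt hxs)
  refine ((hfd.clm_apply hV).fst).congr ?_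
  filter_upwards [hN] with y hy
  have hχd : MDifferentiableAt (RModel n) 𝓘(ℝ, EuclideanSpace ℝ (Fin (2 * n + 1)))
      (extChartAt (RModel n) x) y := (contMDiffAt_extChartAt' hy.1).mdifferentiableAt hr0
  have h1 := diffV_comp (g := e ∘ χ.symm) (c := extChartAt (RModel n) x)
    ((hcd.contDiffAt (hO.mem_nhds (hmem y hy))).differentiableAt hr0) hχd (V y)
  have h2 : (fun y => (e ∘ χ.symm) (extChartAt (RModel n) x y)) =ᶠ[𝓝 y] e :=
    Set.EqOn.eventuallyEq_of_mem (s := χ.source) (fun y' hy' => congrArg e (χ.left_inv hy'))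
      (χ.open_source.mem_nhds hy.1)
  rw [diffV_congr h2] at h1
  exact congrArg Prod.fst h1.symm

/-- At a critical point, the differential of the derivative along `D` in any frame is the leafwise
complex Hessian in CR coordinates; it is nondegenerate if the CR 1-jet is transversal. -/
theorem AlmostCRStructure.IsCRChartAt.injective_leafDeriv_leafDeriv (hr : 1 ≤ r)
    [IsManifold (RModel n) r M] (he : S.IsCRChartAt r x e) {c : M → ℂ}
    (hf : CRContDiffOn (ContinuousLinearMap.inl ℝ (Fin n → ℂ) ℝ) r (c ∘ e.symm) e.target)
    (hcrit : leafDeriv (ContinuousLinearMap.inl ℝ (Fin n → ℂ) ℝ) (c ∘ e.symm) 0 = 0)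
    {V : Fin n → ∀ y : M, S.D y} (hV : S.IsFrameNear x V)
    (htrans : TransversalAlong (S.D x) (diffC n c x).toLinearMap
      (diffCm n (fun y i => diffC n c y (V i y)) x).toLinearMap) :
    Function.Injective (leafDeriv (ContinuousLinearMap.inl ℝ (Fin n → ℂ) ℝ)
      (leafDeriv (ContinuousLinearMap.inl ℝ (Fin n → ℂ) ℝ) (c ∘ e.symm)) 0) := by
  let ι := ContinuousLinearMap.inl ℝ (Fin n → ℂ) ℝ
  let G : (Fin n → ℂ) × ℝ → (Fin n → ℂ) →L[ℂ] ℂ := leafDeriv ι (c ∘ e.symm)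
  have hG : CRContDiffOn ι r G e.target := hf.leafDeriv_crContDiffOn hr e.open_target
  have h0 : (0 : (Fin n → ℂ) × ℝ) ∈ e.target := by
    rw [← he.map_center]
    exact e.map_source he.mem_source
  have hsymm0 : e.symm 0 = x := by rw [← he.map_center, e.left_inv he.mem_source]
  let ζ : Fin n → M → (Fin n → ℂ) := fun i y => (diffCR e y (V i y)).1
  have hζ : ∀ i, ContinuousAt (fun p => ζ i (e.symm p)) 0 := fun i => by
    have h1 : ContinuousAt (ζ i) x := he.continuousAt_frame hr (hV.contMDiffAt i).continuousAt
    rw [← hsymm0] at h1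
    exact ContinuousAt.comp (f := e.symm) (g := ζ i) h1 (e.symm.continuousAt h0)
  have hGd : HasFDerivAt (fun p => (G p).restrictScalars ℝ)
      ((ContinuousLinearMap.restrictScalarsL ℂ (Fin n → ℂ) ℂ ℝ ℝ).comp (fderiv ℝ G 0)) 0 :=
    (ContinuousLinearMap.restrictScalarsL ℂ (Fin n → ℂ) ℂ ℝ ℝ).hasFDerivAt.comp 0
      (hG.differentiableAt hr e.open_target h0).hasFDerivAt
  have hK : HasFDerivAt (fun p i => G p (ζ i (e.symm p)))
      (ContinuousLinearMap.pi fun i => ((ContinuousLinearMap.restrictScalarsL ℂ (Fin n → ℂ) ℂ ℝ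
        ℝ).comp (fderiv ℝ G 0)).flip (ζ i (e.symm 0))) 0 :=
    hasFDerivAt_pi.2 fun i => hasFDerivAt_clm_apply_of_eq_zero hGd
      (by ext w; simp [G, ι, hcrit]) (hζ i)
  have hcomp : ∀ v, diffCm n (fun y i => diffC n c y (V i y)) x v =
      fun i => fderiv ℝ G 0 (diffCR e x v) (ζ i x) := by
    intro v
    have h1 : (fun y => (fun p i => G p (ζ i (e.symm p))) (e y)) =ᶠ[𝓝 x]
        fun y i => diffC n c y (V i y) := by
      filter_upwards [e.open_source.mem_nhds he.mem_source] with y hy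
      funext i
      simp only [e.left_inv hy]
      exact he.leafDeriv_comp_symm hr hf hy (V i y)
    rw [← he.map_center] at hK
    have h2 := diffV_comp (c := e) hK.differentiableAt (he.mdifferentiableAt hr he.mem_source) v
    rw [diffV_congr h1, hK.fderiv, he.map_center, hsymm0] at h2
    exact h2
  let A : (Fin n → ℂ) →ₗ[ℂ] (Fin n → ℂ) :=
    LinearMap.pi fun i => ((leafDeriv ι G 0).flip (ζ i x)).toLinearMap
  have hA : Function.Surjective A := by
    intro b
    obtain ⟨v, hv, hvb⟩ := htrans.exists_mem b
    refine ⟨(diffCR e x v).1, ?_⟩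
    have h1 : diffCm n (fun y i => diffC n c y (V i y)) x v = b := hvb
    rw [← h1, hcomp v]
    funext i
    have h2 := he.diffCR_eq_inl he.mem_source ⟨v, hv⟩
    change leafDeriv ι G 0 (diffCR e x v).1 (ζ i x) = _
    rw [hG.leafDeriv_apply hr e.open_target h0, ← h2]
  have hAinj : Function.Injective A := LinearMap.injective_iff_surjective.2 hA
  intro z w hzw
  refine hAinj (funext fun i => ?_)
  exact DFunLike.congr_fun hzw (ζ i x)

end Jets

/-! ### Singular points -/

section Singular

open CPSpace

variable {n N : ℕ} {M : Type*} [TopologicalSpace M]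
  [ChartedSpace (EuclideanSpace ℝ (Fin (2 * n + 1))) M]
  {S : AlmostCRStructure n M} {h r : ℕ∞} {j : M → CPSpace N} {k : ℕ}
  {P₀ P₁ : MvPolynomial (Fin (N + 1)) ℂ}

namespace CPSpace

/-- The quotient of the dehomogenized polynomials that expresses a pencil in affine coordinates. -/
noncomputable def dehomQuotient (P₀ P₁ : MvPolynomial (Fin (N + 1)) ℂ) (i : Fin (N + 1))
    (b : Fin 2) (u : Fin N → ℂ) : ℂ :=
  dehom i (![P₀, P₁] (b.succAbove 0)) u / dehom i (![P₀, P₁] b) u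

theorem contDiffAt_dehomQuotient {i : Fin (N + 1)} {b : Fin 2} {u : Fin N → ℂ}
    (hu : dehom i (![P₀, P₁] b) u ≠ 0) : ContDiffAt ℂ ω (dehomQuotient P₀ P₁ i b) u :=
  (contDiff_dehom i _).contDiffAt.div (contDiff_dehom i _).contDiffAt hu

end CPSpace

/-- The points near `x` that `j` maps to the affine chart around `j x` and the pencil to the affine
chart around its value at `x`. -/
def pencilDomain (j : M → CPSpace N) (P₀ P₁ : MvPolynomial (Fin (N + 1)) ℂ) (x : M) : Set M :=
  {y ∈ affineDomain j x | dehom (index (j x)) (![P₀, P₁]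
    (index (AlmostCRStructure.pencil j P₀ P₁ x))) (affineLift j x y) ≠ 0}

namespace IsLefschetzPencil

open AlmostCRStructure

theorem isHomogeneous_member (hP : IsLefschetzPencil S j k P₀ P₁) (b : Fin 2) :
    (![P₀, P₁] b).IsHomogeneous k := by
  fin_cases b
  · exact hP.isHomogeneous₀
  · exact hP.isHomogeneous₁

theorem mem_pencilDomain_self (hP : IsLefschetzPencil S j k P₀ P₁) {x : M}
    (hx : x ∉ base j P₀ P₁) : x ∈ pencilDomain j P₀ P₁ x := by
  refine ⟨mem_affineDomain_self j x, ?_⟩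
  have h1 := (pencilMap_rep_ne_zero_iff hx (index (pencil j P₀ P₁ x))).1 (rep_index_ne_zero _)
  rwa [Ne, eval_rep_eq_zero_iff (hP.isHomogeneous_member _) (mem_affineDomain_self j x)] at h1

theorem eval_rep_ne_zero (hP : IsLefschetzPencil S j k P₀ P₁) {x y : M}
    (hy : y ∈ pencilDomain j P₀ P₁ x) :
    MvPolynomial.eval (j y).rep (![P₀, P₁] (index (pencil j P₀ P₁ x))) ≠ 0 := by
  rw [Ne, eval_rep_eq_zero_iff (hP.isHomogeneous_member _) hy.1]
  exact hy.2

theorem notMem_base (hP : IsLefschetzPencil S j k P₀ P₁) {x y : M}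
    (hy : y ∈ pencilDomain j P₀ P₁ x) : y ∉ base j P₀ P₁ :=
  notMem_baseLocus_of_eval_ne_zero (hP.eval_rep_ne_zero hy)

theorem pencil_rep_ne_zero (hP : IsLefschetzPencil S j k P₀ P₁) {x y : M}
    (hy : y ∈ pencilDomain j P₀ P₁ x) :
    (pencil j P₀ P₁ y).rep (index (pencil j P₀ P₁ x)) ≠ 0 :=
  (pencilMap_rep_ne_zero_iff (hP.notMem_base hy) _).2 (hP.eval_rep_ne_zero hy)

theorem localCoord_eq (hP : IsLefschetzPencil S j k P₀ P₁) {x y : M}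
    (hy : y ∈ pencilDomain j P₀ P₁ x) :
    localCoord (pencil j P₀ P₁) x y = dehomQuotient P₀ P₁ (index (j x))
      (index (pencil j P₀ P₁ x)) (affineLift j x y) :=
  affineCoord_pencilMap hP.isHomogeneous₀ hP.isHomogeneous₁ (hP.notMem_base hy) hy.1 _

theorem isOpen_pencilDomain (hj : S.IsCREmbedding h j) (x : M) :
    IsOpen (pencilDomain j P₀ P₁ x) := by
  have h1 : ContinuousOn (fun y => dehom (index (j x)) (![P₀, P₁] (index (pencil j P₀ P₁ x)))
      (affineLift j x y)) (affineDomain j x) :=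
    (contDiff_dehom _ _).continuous.comp_continuousOn
      (contMDiffOn_affineLift hj.contMDiff x).continuousOn
  exact h1.isOpen_inter_preimage (isOpen_affineDomain hj.isEmbedding.continuous x) isOpen_ne

theorem localCoord_eventuallyEq (hP : IsLefschetzPencil S j k P₀ P₁) (hj : S.IsCREmbedding h j)
    {x y : M} (hy : y ∈ pencilDomain j P₀ P₁ x) :
    localCoord (pencil j P₀ P₁) x =ᶠ[𝓝 y] fun y => dehomQuotient P₀ P₁ (index (j x))
      (index (pencil j P₀ P₁ x)) (affineLift j x y) :=
  Set.EqOn.eventuallyEq_of_mem (s := pencilDomain j P₀ P₁ x) (fun _ hz => hP.localCoord_eq hz)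
    ((isOpen_pencilDomain hj x).mem_nhds hy)

theorem contMDiffOn_localCoord (hP : IsLefschetzPencil S j k P₀ P₁) (hj : S.IsCREmbedding h j)
    (x : M) : ContMDiffOn (RModel n) 𝓘(ℝ, ℂ) h (localCoord (pencil j P₀ P₁) x)
      (pencilDomain j P₀ P₁ x) := by
  refine ContMDiffOn.congr (fun y hy => ?_) fun y hy => hP.localCoord_eq hy
  have h1 : ContMDiffAt 𝓘(ℝ, Fin N → ℂ) 𝓘(ℝ, ℂ) h (dehomQuotient P₀ P₁ (index (j x))
      (index (pencil j P₀ P₁ x))) (affineLift j x y) :=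
    (((contDiffAt_dehomQuotient hy.2).restrict_scalars ℝ).of_le le_top).contMDiffAt
  exact h1.comp_contMDiffWithinAt y
    ((contMDiffOn_affineLift hj.contMDiff x y hy.1).mono fun z hz => hz.1)

theorem mdifferentiableAt_localCoord (hh : 1 ≤ h) (hP : IsLefschetzPencil S j k P₀ P₁)
    (hj : S.IsCREmbedding h j) {x y : M} (hy : y ∈ pencilDomain j P₀ P₁ x) :
    MDifferentiableAt (RModel n) 𝓘(ℝ, ℂ) (localCoord (pencil j P₀ P₁) x) y :=
  ((hP.contMDiffOn_localCoord hj x).contMDiffAt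
    ((isOpen_pencilDomain hj x).mem_nhds hy)).mdifferentiableAt
    (by exact_mod_cast (zero_lt_one.trans_le hh).ne')

theorem diffV_localCoord_J (hh : 1 ≤ h) (hP : IsLefschetzPencil S j k P₀ P₁)
    (hj : S.IsCREmbedding h j) {x y : M} (hy : y ∈ pencilDomain j P₀ P₁ x) (v : S.D y) :
    diffV n (localCoord (pencil j P₀ P₁) x) y (S.J y v) =
      Complex.I • diffV n (localCoord (pencil j P₀ P₁) x) y v := by
  rw [diffV_congr (hP.localCoord_eventuallyEq hj hy)]
  exact hj.diffV_comp_affineLift_J hh hy.1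
    ((contDiffAt_dehomQuotient hy.2).differentiableAt (by simp)) v

/-- The differential of the pencil on `M` in the affine coordinate of the projective line. -/
theorem diffC_localCoord_eq_diffCP (hh : 1 ≤ h) (hP : IsLefschetzPencil S j k P₀ P₁)
    (hj : S.IsCREmbedding h j) {x : M} (hx : x ∉ base j P₀ P₁) (v : TangentSpace (RModel n) x) :
    diffC n (localCoord (pencil j P₀ P₁) x) x v = diffCP n (pencil j P₀ P₁) x v 0 := by
  set φ := pencil j P₀ P₁ with hφ
  have hxd := hP.mem_pencilDomain_self hx
  have hlift : affineLift φ x = fun y _ => localCoord φ x y := by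
    funext y l
    fin_cases l
    rfl
  have hc : MDifferentiableAt (RModel n) 𝓘(ℝ, Fin 1 → ℂ) (affineLift φ x) x := by
    rw [hlift]
    exact mdifferentiableAt_comp (g := fun z : ℂ => (fun _ => z : Fin 1 → ℂ))
      (by fun_prop) (hP.mdifferentiableAt_localCoord hh hj hxd)
  have hφd : MDifferentiableAt (RModel n) 𝓘(ℝ, Fin 1 → ℂ) φ x := by
    have h1 : MDifferentiableAt 𝓘(ℝ, Fin 1 → ℂ) 𝓘(ℝ, Fin 1 → ℂ)
        (affineChart (index (φ x))).symm (affineLift φ x x) :=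
      mdifferentiableAt_atlas_symm (e := affineChart (index (φ x)))
        (show affineChart _ ∈ atlas (Fin 1 → ℂ) (CPSpace 1) from Set.mem_range_self _) trivial
    refine (h1.comp x hc).congr_of_eventuallyEq ?_
    refine Set.EqOn.eventuallyEq_of_mem (s := pencilDomain j P₀ P₁ x) (fun y hy => ?_)
      ((isOpen_pencilDomain hj x).mem_nhds hxd)
    exact ((affineChart (index (φ x))).left_inv (hP.pencil_rep_ne_zero hy)).symm
  rw [← diffV_affineLift_self hφd]
  have h2 := diffV_comp (g := ContinuousLinearMap.proj (R := ℝ) (φ := fun _ : Fin 1 => ℂ) 0)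
    (ContinuousLinearMap.differentiableAt _) hc v
  rw [ContinuousLinearMap.fderiv] at h2
  exact h2

/-- The differential on `M` is the restriction of the holomorphic differential. -/
theorem diffC_localCoord_eq_pencilDiff (hh : 1 ≤ h) (hP : IsLefschetzPencil S j k P₀ P₁)
    (hj : S.IsCREmbedding h j) {x : M} (hx : x ∉ base j P₀ P₁) (v : TangentSpace (RModel n) x) :
    diffC n (localCoord (pencil j P₀ P₁) x) x v =
      pencilDiff P₀ P₁ (pencilMap P₀ P₁ (j x)) (j x) (diffCP n j x v) := by
  set i := index (j x)
  set b := index (pencil j P₀ P₁ x) with hb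
  have hxd := hP.mem_pencilDomain_self hx
  have hκ : MDifferentiableAt 𝓘(ℂ, Fin N → ℂ) 𝓘(ℂ, Fin N → ℂ) (affineCoord i) (j x) :=
    mdifferentiableAt_atlas (e := affineChart i)
      (show affineChart _ ∈ atlas (Fin N → ℂ) (CPSpace N) from Set.mem_range_self _)
      (rep_index_ne_zero (j x))
  have hq : MDifferentiableAt 𝓘(ℂ, Fin N → ℂ) 𝓘(ℂ, ℂ)
      (fun p => dehomQuotient P₀ P₁ i b (affineCoord i p)) (j x) := by
    have h1 : DifferentiableAt ℂ (dehomQuotient P₀ P₁ i b) (affineCoord i (j x)) :=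
      (contDiffAt_dehomQuotient hxd.2).differentiableAt (by simp)
    exact h1.mdifferentiableAt.comp (j x) hκ
  have hO : IsOpen {p : CPSpace N | p.rep i ≠ 0 ∧ dehom i (![P₀, P₁] b) (affineCoord i p) ≠ 0} :=
    ((contDiff_dehom _ _).continuous.comp_continuousOn
      (continuousOn_affineCoord i)).isOpen_inter_preimage (isOpen_rep_ne_zero i) isOpen_ne
  have heq : (fun p => lineCoord (pencilMap P₀ P₁ (j x)) (pencilMap P₀ P₁ p)) =ᶠ[𝓝 (j x)]
      fun p => dehomQuotient P₀ P₁ i b (affineCoord i p) := by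
    refine Set.EqOn.eventuallyEq_of_mem (fun p hp => ?_) (hO.mem_nhds ⟨hxd.1, hxd.2⟩)
    refine affineCoord_pencilMap hP.isHomogeneous₀ hP.isHomogeneous₁
      (notMem_baseLocus_of_eval_ne_zero (b := b) ?_) hp.1 _
    rw [Ne, eval_rep_eq_zero_iff (hP.isHomogeneous_member b) hp.1]
    exact hp.2
  exact diffV_comp_CPSpace (hq.congr_of_eventuallyEq heq).hasMFDerivAt
    (hj.mdifferentiableAt hh x) v

/-- The transversality of the holomorphic jet excludes critical points on all of `M`: its
differential would map a space of real dimension `2n + 1` onto one of complex dimension `n + 1`. -/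
theorem diffC_localCoord_ne_zero (hh : 1 ≤ h) (hP : IsLefschetzPencil S j k P₀ P₁)
    (hj : S.IsCREmbedding h j) {x : M} (hx : x ∉ base j P₀ P₁) :
    diffC n (localCoord (pencil j P₀ P₁) x) x ≠ 0 := by
  intro hzero
  obtain ⟨W, -, hW⟩ := hP.transversal_M x hx (by
    intro w hw
    have hle : complexEnvelope n j x ≤
        (pencilDiff P₀ P₁ (pencilMap P₀ P₁ (j x)) (j x)).toLinearMap.ker := by
      refine Submodule.span_le.2 ?_
      rintro _ ⟨v, rfl⟩
      have h1 := hP.diffC_localCoord_eq_pencilDiff hh hj hx v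
      rw [hzero] at h1
      exact h1.symm
    exact hle hw)
  have hsurj : Function.Surjective (diffCm n (fun y i =>
      pencilDiff P₀ P₁ (pencilMap P₀ P₁ (j x)) (j y) (W i y)) x).toLinearMap := fun b =>
    (hW.exists_mem b).imp fun v hv => hv.2
  have h1 := LinearMap.finrank_le_finrank_of_surjective hsurj
  rw [finrank_tangentSpace, Module.finrank_pi_fintype] at h1
  simp at h1
  omega

/-- Normal form of a Lefschetz pencil at a singular point. -/
theorem exists_crChart_singular (hh : 1 ≤ h) (hr : 1 ≤ r) (hrh : r ≤ h)
    [IsManifold (RModel n) h M] (hflat : S.IsLeviFlat r) (hj : S.IsCREmbedding h j)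
    (hP : IsLefschetzPencil S j k P₀ P₁) {x : M} (hx : x ∈ S.singularSet j P₀ P₁) :
    ∃ (e : OpenPartialHomeomorph M ((Fin n → ℂ) × ℝ))
      (ψ : OpenPartialHomeomorph (CPSpace 1) (Fin 1 → ℂ)) (t : ℝ → ℂ),
      S.IsCRChartAt r x e ∧
      ψ ∈ IsManifold.maximalAtlas 𝓘(ℂ, Fin 1 → ℂ) ω (CPSpace 1) ∧
      e.source ⊆ (base j P₀ P₁)ᶜ ∧
      (∀ y ∈ e.source, pencil j P₀ P₁ y ∈ ψ.source) ∧
      ContDiffOn ℝ r t (Prod.snd '' e.target) ∧ t 0 = 0 ∧ deriv t 0 ≠ 0 ∧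
      ∀ y ∈ e.source, ψ (pencil j P₀ P₁ y) 0 = (∑ i, (e y).1 i ^ 2) + t (e y).2 := by
  have : IsManifold (RModel n) r M := IsManifold.of_le (n := (h : ℕ∞ω)) (by exact_mod_cast hrh)
  obtain ⟨hxB, hxD⟩ := hx
  have hxd := hP.mem_pencilDomain_self hxB
  set φ := pencil j P₀ P₁ with hφ
  set c := localCoord φ x with hc
  set ι := ContinuousLinearMap.inl ℝ (Fin n → ℂ) ℝ with hι
  -- Linear coordinates on the image of `D x` provide CR coordinates.
  obtain ⟨E, hEn, hE⟩ := hj.exists_image_D x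
  obtain ⟨Λ, hΛ⟩ := exists_clm_injOn E hEn
  have hHd : ∀ u, HasFDerivAt (fun w => Λ (w - affineLift j x x)) Λ u := fun u => by
    have h1 := Λ.hasFDerivAt.comp u ((hasFDerivAt_id u).sub_const (affineLift j x x))
    rwa [ContinuousLinearMap.comp_id] at h1
  obtain ⟨e, he, hesrc, -⟩ := S.exists_crChart (H := fun w => Λ (w - affineLift j x x)) hh hr hrh
    hflat hj x (Λ.contDiff.comp (contDiff_id.sub contDiff_const)) (by simp)
    (fun v hv => by
      rw [(hHd _).fderiv] at hv
      exact Subtype.ext (hj.injective_diff x (by simpa using hΛ _ ((hE _).2 ⟨v, rfl⟩) hv)))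
    (isOpen_pencilDomain (P₀ := P₀) (P₁ := P₁) hj x) hxd
  have hdom : ∀ y ∈ e.source, y ∈ pencilDomain j P₀ P₁ x := fun y hy => (hesrc hy).1
  have h0t : (0 : (Fin n → ℂ) × ℝ) ∈ e.target := by
    rw [← he.map_center]
    exact e.map_source he.mem_source
  have hsymm0 : e.symm 0 = x := by rw [← he.map_center, e.left_inv he.mem_source]
  have hf : CRContDiffOn ι r (c ∘ e.symm) e.target :=
    he.crContDiffOn_comp_symm hr
      (((hP.contMDiffOn_localCoord hj x).of_le (by exact_mod_cast hrh)).mono hdom)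
      fun y hy v => hP.diffV_localCoord_J hh hj (hdom y hy) v
  have hcrit : leafDeriv ι (c ∘ e.symm) 0 = 0 := by
    ext1 z
    obtain ⟨v, rfl⟩ := he.exists_diffCR_fst_eq hr he.mem_source z
    have h1 := he.leafDeriv_comp_symm hr hf he.mem_source v
    rw [he.map_center] at h1
    rw [h1]
    refine (hP.diffC_localCoord_eq_diffCP hh hj hxB v).trans ?_
    rw [hxD v]
    rfl
  obtain ⟨V, hV, htrans⟩ := hP.transversal_D x hxB hxD
  have hnd := he.injective_leafDeriv_leafDeriv hr hf hcrit hV htrans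
  -- Together with `hcrit`, a vanishing derivative along `s` would make all of `dc` vanish at `x`.
  have hs : fderiv ℝ (c ∘ e.symm) 0 (0, 1) ≠ 0 := by
    intro hs
    refine hP.diffC_localCoord_ne_zero hh hj hxB (ContinuousLinearMap.ext fun v => ?_)
    have hd := hf.differentiableAt hr e.open_target h0t
    rw [← he.map_center] at hd
    have h1 := he.fderiv_comp_symm hr he.mem_source hd v
    rw [he.map_center] at h1
    refine h1.symm.trans ?_
    have h2 : diffCR e x v = ι (diffCR e x v).1 + (diffCR e x v).2 • ((0, 1) : (Fin n → ℂ) × ℝ) := by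
      refine Prod.ext ?_ ?_ <;> simp [hι]
    rw [h2, map_add, map_smul, hs, ← hf.leafDeriv_apply hr e.open_target h0t, hcrit]
    simp
  obtain ⟨ζ, Ψ, t, h0Ψ, hΨsub, hΨ0, hΨ, hζ, hΨsymm, ht, ht0, ht', hΨf⟩ :=
    hf.exists_morse_chart hr (Module.finrank_fin_fun ℂ) e.open_target h0t hcrit hnd hs
  have hsrc : ∀ y ∈ (e.trans Ψ).source, y ∈ e.source ∧ e y ∈ Ψ.source := fun y hy => by
    rwa [OpenPartialHomeomorph.trans_source] at hy
  -- The affine chart of the projective line, translated to be centered at the critical value.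
  let ψ := (affineChart (index (φ x))).transHomeomorph (Homeomorph.subRight fun _ : Fin 1 => c x)
  refine ⟨e.trans Ψ, ψ, t, he.trans_foliated hr h0Ψ hΨ0 hΨ hζ hΨsymm, ?_,
    fun y hy => hP.notMem_base (hdom y (hsrc y hy).1),
    fun y hy => hP.pencil_rep_ne_zero (hdom y (hsrc y hy).1), ht.mono ?_, ht0, ht',
    fun y hy => ?_⟩
  · have hmem : affineChart (index (φ x)) ∈ IsManifold.maximalAtlas 𝓘(ℂ, Fin 1 → ℂ) ω (CPSpace 1) :=
      IsManifold.subset_maximalAtlas (Set.mem_range_self _)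
    refine OpenPartialHomeomorph.mem_maximalAtlas_of_contMDiffOn ψ ?_ ?_
    · have h1 : ContMDiff 𝓘(ℂ, Fin 1 → ℂ) 𝓘(ℂ, Fin 1 → ℂ) ω
          fun u : Fin 1 → ℂ => u - fun _ => c x := (contDiff_id.sub contDiff_const).contMDiff
      exact h1.comp_contMDiffOn (contMDiffOn_of_mem_maximalAtlas hmem)
    · have h1 : ContMDiff 𝓘(ℂ, Fin 1 → ℂ) 𝓘(ℂ, Fin 1 → ℂ) ω
          fun u : Fin 1 → ℂ => u + fun _ => c x := (contDiff_id.add contDiff_const).contMDiff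
      exact (contMDiffOn_symm_of_mem_maximalAtlas hmem).comp h1.contMDiffOn fun u _ => trivial
  · refine Set.image_mono ?_
    rw [OpenPartialHomeomorph.trans_target]
    exact Set.inter_subset_left
  · have h1 := hΨf (e y) (hsrc y hy).2
    rw [Function.comp_apply, Function.comp_apply, e.left_inv (hsrc y hy).1, hsymm0] at h1
    have h2 : (e.trans Ψ) y = (ζ (e y), (e y).2) := by
      rw [OpenPartialHomeomorph.coe_trans, Function.comp_apply, hΨ]
    rw [h2]
    change c y - c x = _
    rw [h1]
    ring

end IsLefschetzPencil

end Singular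

/-! ### Normal forms of a Lefschetz pencil -/

theorem mainTheorem8 {n N : ℕ} {h r : ℕ∞} (hh : 2 ≤ h) (hr : h - 1 ≤ r) (hrh : r ≤ h)
    {M : Type*} [TopologicalSpace M] [ChartedSpace (EuclideanSpace ℝ (Fin (2 * n + 1))) M]
    [IsManifold (RModel n) (h : ℕ∞ω) M]
    (S : AlmostCRStructure n M) (hflat : S.IsLeviFlat r)
    (j : M → CPSpace N) (hj : S.IsCREmbedding h j)
    (k : ℕ) (P₀ P₁ : MvPolynomial (Fin (N + 1)) ℂ) (hP : IsLefschetzPencil S j k P₀ P₁) :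
    (∀ x ∈ AlmostCRStructure.base j P₀ P₁,
      ∃ (h0 : 0 < n) (h1 : 1 < n) (e : OpenPartialHomeomorph M ((Fin n → ℂ) × ℝ))
        (ψ : OpenPartialHomeomorph (CPSpace 1) (Fin 1 → ℂ)),
        S.IsCRChartAt r x e ∧
        ψ ∈ IsManifold.maximalAtlas 𝓘(ℂ, Fin 1 → ℂ) ω (CPSpace 1) ∧
        (∀ y ∈ e.source, y ∈ AlmostCRStructure.base j P₀ P₁ ↔
          (e y).1 ⟨0, h0⟩ = 0 ∧ (e y).1 ⟨1, h1⟩ = 0) ∧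
        (∀ y ∈ e.source \ AlmostCRStructure.base j P₀ P₁,
          (AlmostCRStructure.pencil j P₀ P₁ y ∈ ψ.source ↔ (e y).1 ⟨0, h0⟩ ≠ 0) ∧
          ((e y).1 ⟨0, h0⟩ ≠ 0 →
            ψ (AlmostCRStructure.pencil j P₀ P₁ y) 0 =
              (e y).1 ⟨1, h1⟩ / (e y).1 ⟨0, h0⟩))) ∧
    (∀ x ∈ S.singularSet j P₀ P₁,
      ∃ (e : OpenPartialHomeomorph M ((Fin n → ℂ) × ℝ))
        (ψ : OpenPartialHomeomorph (CPSpace 1) (Fin 1 → ℂ)) (t : ℝ → ℂ),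
        S.IsCRChartAt r x e ∧
        ψ ∈ IsManifold.maximalAtlas 𝓘(ℂ, Fin 1 → ℂ) ω (CPSpace 1) ∧
        e.source ⊆ (AlmostCRStructure.base j P₀ P₁)ᶜ ∧
        (∀ y ∈ e.source, AlmostCRStructure.pencil j P₀ P₁ y ∈ ψ.source) ∧
        ContDiffOn ℝ ((h - 1 : ℕ∞) : ℕ∞ω) t (Prod.snd '' e.target) ∧
        t 0 = 0 ∧ deriv t 0 ≠ 0 ∧
        ∀ y ∈ e.source, ψ (AlmostCRStructure.pencil j P₀ P₁ y) 0 =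
          (∑ i, (e y).1 i ^ 2) + t (e y).2) := by
  have hh1 : 1 ≤ h := le_trans (by norm_num) hh
  have hr1 : 1 ≤ r := (show (1 : ℕ∞) = 2 - 1 from rfl) ▸ (tsub_le_tsub_right hh 1).trans hr
  refine ⟨fun x hx => hP.exists_crChart_base hh1 hr1 hrh hflat hj hx, fun x hx => ?_⟩
  obtain ⟨e, ψ, t, he, hψ, hB, hsrc, ht, ht0, ht', hf⟩ :=
    hP.exists_crChart_singular hh1 hr1 hrh hflat hj hx
  exact ⟨e, ψ, t, he, hψ, hB, hsrc, ht.of_le (by exact_mod_cast hr), ht0, ht', hf⟩
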